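/- **Model.** An honest player has sent a commit message. Two attackers $1,2$ of strengths $\gamma_1\ge\gamma_2>0$ simultaneously decide whether to commit (to one given message), possibly at random and independently; a commit message costs $c>0$. Commitments and then a state $s$ from a finite set (with probabilities $p(s)$) are publicly revealed, and in the next period, discounted by $\beta\in[0,1]$, every attacker who committed chooses a spending $f_i\ge 0$, possibly at random; an attacker who did not commit gets $0$. Let $P(s)\ge0$ be the value of a successful attack in state $s$, and let $q:[0,\infty)\to[0,1]$ be strictly increasing, strictly concave and differentiable. A lone attacker $i$ spending $f$ gets $P(s)\gamma_iq(f)-f$. If both committed, attacker $i$ gets $P(s)\gamma_iq(f_i)-f_i$ if $f_i>f_{-i}$ and $-f_i$ if $f_i<f_{-i}$; when $f_1=f_2=x$ an arbitrary measurable tie-breaking rule lets attacker $i$ win with a probability $t_i(x)$, $t_1+t_2\le1$. "Equilibrium" means subgame-perfect equilibrium, mixed strategies allowed (spending laws have finite mean). **Values.** Put $$V(\gamma_i,s)=\max_{f\ge0}\{P(s)\gamma_iq(f)-f\},\qquad V(\gamma_i)=\sum_s p(s)V(\gamma_i,s).$$ Let $\underline f_1(s)$ be the maximizer for $i=1$,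 and let $\overline f_2(s)$ be the largest $f\ge 0$ with $P(s)\gamma_2q(f)=f$. Put $\underline V(\gamma_1,s)=P(s)\gamma_1q(\overline f_2(s))-\overline f_2(s)$ if $\underline f_1(s)<\overline f_2(s)$ ("sufficiently similar attackers") and $\underline V(\gamma_1,s)=V(\gamma_1,s)$ otherwise, and let $\underline V(\gamma_1)=\sum_sp(s)\underline V(\gamma_1,s)$. **Theorem.** 0. The maximum defining $V(\gamma_i,s)$ is attained. In every state the contest between two committed attackers has an equilibrium, and in each of its equilibria attacker 1 earns $\underline V(\gamma_1,s)$ and attacker 2 earns $0$. If the attackers are sufficiently similar in state $s$, then $\underline V(\gamma_1,s)<V(\gamma_1,s)$. 1. There is no equilibrium in which both attackers commit with probability $1$. 2. If $\beta\underline V(\gamma_1)>c$, or if $\beta V(\gamma_1)>c\ge\beta\underline V(\gamma_1)$ and $c>\beta V(\gamma_2)$, then an equilibrium exists, and in every equilibrium attacker 1 commits with probability $1$ and attacker 2 with probability $0$. 3. If $\beta V(\gamma_1)>c>\beta\underline V(\gamma_1)$ and $\beta V(\gamma_2)>c$, then the pairs of commitment probabilities that occur in equilibria are exactly $(1,0)$,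 $(0,1)$ and one pair $(\alpha_1,\alpha_2)\in(0,1)^2$, for which $$\beta(1-\alpha_1)V(\gamma_2)=c,\qquad \beta\big[(1-\alpha_2)V(\gamma_1)+\alpha_2\underline V(\gamma_1)\big]=c .$$ In every equilibrium with the pair $(\alpha_1,\alpha_2)$ each attacker is indifferent between committing and not committing, both commit with probability $\alpha_1\alpha_2$, none with probability $(1-\alpha_1)(1-\alpha_2)$, and exactly one with the remaining probability. 4. If $c>\beta V(\gamma_1)$, then an equilibrium exists, and in every equilibrium no attacker commits (so there is no front running). If $c=\beta V(\gamma_1)$, there is an equilibrium in which no attacker commits. -/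

import Mathlib

open MeasureTheory Set
open scoped NNReal

/-- Primitives of the attackers' game that follows the honest player's commit message.
The two attackers are indexed by `Fin 2`: index `0` is the strong attacker (attacker 1 in the usual
numbering) and index `1` the weak one (attacker 2). -/
structure AttackGame (S : Type*) [Fintype S] where
  /-- the attackers' common belief about the state, given that the honest player committed -/
  prob : S → ℝ
  prob_nonneg : ∀ s, 0 ≤ prob s
  prob_sum : ∑ s, prob s = 1
  /-- what a successful front-runner earns in state `s` with the message that attackers commit -/
  prize : S → ℝ
  prize_nonneg : ∀ s, 0 ≤ prize s
  /-- baseline success probability as a function of spending (only its values on `[0, ∞)` matter) -/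
  q : ℝ → ℝ
  q_mem : ∀ f, 0 ≤ f → q f ∈ Icc (0 : ℝ) 1
  q_strictMono : StrictMonoOn q (Ici 0)
  q_strictConcave : StrictConcaveOn ℝ (Ici 0) q
  q_differentiable : DifferentiableOn ℝ q (Ici 0)
  /-- strengths -/
  γ : Fin 2 → ℝ
  γ_pos : ∀ i, 0 < γ i
  γ_le : γ 1 ≤ γ 0
  /-- arbitrary tie-breaking rule: `tie i x` is the probability that attacker `i` wins the right to
  attack if both spend `x` -/
  tie : Fin 2 → ℝ≥0 → ℝ
  tie_measurable : ∀ i, Measurable (tie i)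
  tie_nonneg : ∀ i x, 0 ≤ tie i x
  tie_sum_le : ∀ x, tie 0 x + tie 1 x ≤ 1
  /-- cost of a commit message -/
  c : ℝ
  c_pos : 0 < c
  /-- discount factor -/
  β : ℝ
  β_mem : β ∈ Icc (0 : ℝ) 1

/-- A mixed choice of spending: a probability law on `[0, ∞)` with finite mean. (A law with
infinite mean has expected payoff `-∞` and is never worth playing.) -/
structure MixedSpending where
  law : Measure ℝ≥0
  isProb : IsProbabilityMeasure law
  integrable : Integrable (fun x : ℝ≥0 => (x : ℝ)) law

/-- A (behaviour) strategy of an attacker: the probability of committing and, after having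
committed, the law of spending in each revealed state, when alone and when the other attacker
has committed too. -/
structure AttackStrategy (S : Type*) where
  commit : ℝ
  commit_mem : commit ∈ Icc (0 : ℝ) 1
  solo : S → MixedSpending
  duel : S → MixedSpending

/-- The same strategy with the commitment probability replaced by `p`. -/
def AttackStrategy.withCommit {S : Type*} (τ : AttackStrategy S) (p : ℝ) (hp : p ∈ Icc (0 : ℝ) 1) :
    AttackStrategy S :=
  { τ with commit := p, commit_mem := hp }

/-- Probability of the commitment outcome `a` (`a i = true`: attacker `i` commits). -/
def outcomeProb {S : Type*} (σ : Fin 2 → AttackStrategy S) (a : Fin 2 → Bool) : ℝ :=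
  ∏ i, if a i then (σ i).commit else 1 - (σ i).commit

namespace AttackGame

noncomputable section

variable {S : Type*} [Fintype S] (G : AttackGame S)

/-- Payoff in state `s` of attacker `i` alone, spending `f`. -/
def soloPayoff (i : Fin 2) (s : S) (f : ℝ) : ℝ :=
  G.prize s * G.γ i * G.q f - f

/-- The largest payoff attainable alone in state `s`. -/
def soloValueAt (i : Fin 2) (s : S) : ℝ :=
  sSup (G.soloPayoff i s '' Ici 0)

/-- `V(γ i)`: expected value, over the states, of attacking alone. -/
def V (i : Fin 2) : ℝ :=
  ∑ s, G.prob s * G.soloValueAt i s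

/-- Optimal spending of attacker `i` alone (the maximizer is unique by strict concavity). -/
def optSpending (i : Fin 2) (s : S) : ℝ :=
  sSup {f : ℝ | 0 ≤ f ∧ IsMaxOn (G.soloPayoff i s) (Ici 0) f}

/-- Break-even spending of attacker `i` alone: the largest `f` with `prize * γ i * q f = f`. -/
def breakEven (i : Fin 2) (s : S) : ℝ :=
  sSup {f : ℝ | 0 ≤ f ∧ G.prize s * G.γ i * G.q f = f}

/-- The attackers are sufficiently similar in state `s`. -/
def Similar (s : S) : Prop :=
  G.optSpending 0 s < G.breakEven 1 s

open Classical in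
/-- What the strong attacker earns in state `s` when both attackers committed. -/
def contestValueAt (s : S) : ℝ :=
  if G.Similar s then G.soloPayoff 0 s (G.breakEven 1 s) else G.soloValueAt 0 s

/-- The value `V` underlined of the strong attacker: expected value of facing the other attacker. -/
def Vlow : ℝ :=
  ∑ s, G.prob s * G.contestValueAt s

/-- Probability that `i`, spending `x`, wins the right to attack against spending `y`. -/
def winProb (i : Fin 2) (x y : ℝ≥0) : ℝ :=
  if y < x then 1 else if x = y then G.tie i x else 0

/-- Payoff in state `s` of attacker `i` who spends `x` while the other attacker spends `y`. -/
def duelPayoff (i : Fin 2) (s : S) (x y : ℝ≥0) : ℝ :=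
  G.winProb i x y * (G.prize s * G.γ i * G.q x) - x

/-- Expected payoff alone. -/
def soloExp (i : Fin 2) (s : S) (μ : MixedSpending) : ℝ :=
  ∫ x, G.soloPayoff i s (x : ℝ) ∂μ.law

/-- Expected contest payoff of `i` playing `μ` against `ν`. -/
def duelExp (i : Fin 2) (s : S) (μ ν : MixedSpending) : ℝ :=
  ∫ x, ∫ y, G.duelPayoff i s x y ∂ν.law ∂μ.law

/-- Nash equilibrium (in mixed strategies) of the contest in state `s`. `i.rev` is the opponent. -/
def IsContestEquilibrium (s : S) (μ : Fin 2 → MixedSpending) : Prop :=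
  ∀ (i : Fin 2) (ν : MixedSpending),
    G.duelExp i s ν (μ i.rev) ≤ G.duelExp i s (μ i) (μ i.rev)

/-- Payoff of attacker `i` if the commitment outcome is `a`, evaluated in the commit period. -/
def outcomePayoff (σ : Fin 2 → AttackStrategy S) (i : Fin 2) (a : Fin 2 → Bool) : ℝ :=
  if a i then
    -G.c + G.β * ∑ s, G.prob s *
      (if a i.rev then G.duelExp i s ((σ i).duel s) ((σ i.rev).duel s)
        else G.soloExp i s ((σ i).solo s))
  else 0

/-- Expected payoff of attacker `i` in the whole game. -/
def payoff (σ : Fin 2 → AttackStrategy S) (i : Fin 2) : ℝ :=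
  ∑ a : Fin 2 → Bool, outcomeProb σ a * G.outcomePayoff σ i a

/-- Subgame-perfect equilibrium: optimal play in every reveal-stage subgame (both committed, or
exactly one committed, in each state) and no profitable deviation in the whole game. -/
structure IsSubgamePerfect (σ : Fin 2 → AttackStrategy S) : Prop where
  duel : ∀ s, G.IsContestEquilibrium s (fun i => (σ i).duel s)
  solo : ∀ i s (ν : MixedSpending), G.soloExp i s ν ≤ G.soloExp i s ((σ i).solo s)
  whole : ∀ i (τ : AttackStrategy S), G.payoff (Function.update σ i τ) i ≤ G.payoff σ i

/-- The pairs (commitment probability of the strong attacker, of the weak attacker) that occur in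
subgame-perfect equilibria. -/
def equilibriumCommitments : Set (ℝ × ℝ) :=
  {p | ∃ σ : Fin 2 → AttackStrategy S, G.IsSubgamePerfect σ ∧ p = ((σ 0).commit, (σ 1).commit)}

end

end AttackGame

/-! The contest is an all-pay auction whose prize grows with the winner's own spending, and its
equilibrium payoffs follow from overbidding arguments. Bidding just above `x` earns in the limit at
least the lone payoff at `x`, weighted by the probability that the opponent spends at most `x`,
whatever the tie rule (`measureReal_Iic_mul_le`). The weak attacker never spends beyond his
break-even point, so the strong one secures `contestValueAt` by overbidding it, or by his lone
optimum if that is larger (`contestValueAt_le_duelExp`). Two positive payoffs are impossible: both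
laws would have an atom at a common lowest spending, where each attacker would have to win every tie
(`exists_duelExp_nonpos`). If similar attackers earned more than claimed, the one doing so would
stay below the weak break-even point by a margin, and the rival could profitably overbid; this pins
down both payoffs (`duelExp_zero_eq`, `duelExp_one_eq_zero`).

Existence for similar attackers comes from distribution functions that make the opponent
indifferent. The curve for the weak attacker need not be monotone near zero, so its initial stretch
is replaced by an atom at zero, up to the point `a` where the curve is lowest
(`exists_scale_touching`); the strong attacker then spends at least `a`. Otherwise the strong
attacker's lone optimum deters the weak one.

Since reveal-stage values are unique, the payoff of committing is affine in the opponent's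
commitment probability, and the whole game reduces to a two-player game with two actions each
(`mem_equilibriumCommitments_iff`), solved by the signs of the two gains. -/

namespace AttackGame

/-! ### Lone payoffs: quasiconcavity, optimum and break-even point. -/

variable {S : Type*} [Fintype S] (G : AttackGame S)

/-- Value to attacker `i` of the right to attack in state `s` with spending `f`. -/
noncomputable def reward (i : Fin 2) (s : S) (f : ℝ) : ℝ :=
  G.prize s * G.γ i * G.q f

lemma soloPayoff_eq (i : Fin 2) (s : S) (f : ℝ) : G.soloPayoff i s f = G.reward i s f - f := rfl

lemma scale_nonneg (i : Fin 2) (s : S) : 0 ≤ G.prize s * G.γ i :=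
  mul_nonneg (G.prize_nonneg s) (G.γ_pos i).le

lemma scale_le (s : S) (i : Fin 2) : G.prize s * G.γ i ≤ G.prize s * G.γ 0 := by
  refine mul_le_mul_of_nonneg_left ?_ (G.prize_nonneg s)
  fin_cases i
  · exact le_rfl
  · exact G.γ_le

lemma reward_nonneg (i : Fin 2) (s : S) {f : ℝ} (hf : 0 ≤ f) : 0 ≤ G.reward i s f :=
  mul_nonneg (G.scale_nonneg i s) (G.q_mem f hf).1

lemma reward_le_scale (i : Fin 2) (s : S) {f : ℝ} (hf : 0 ≤ f) :
    G.reward i s f ≤ G.prize s * G.γ i :=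
  mul_le_of_le_one_right (G.scale_nonneg i s) (G.q_mem f hf).2

lemma reward_le_reward_zero (i : Fin 2) (s : S) {f : ℝ} (hf : 0 ≤ f) :
    G.reward i s f ≤ G.reward 0 s f :=
  mul_le_mul_of_nonneg_right (G.scale_le s i) (G.q_mem f hf).1

lemma reward_continuousOn (i : Fin 2) (s : S) : ContinuousOn (G.reward i s) (Ici 0) :=
  continuousOn_const.mul G.q_differentiable.continuousOn

lemma reward_concaveOn (i : Fin 2) (s : S) : ConcaveOn ℝ (Ici 0) (G.reward i s) :=
  G.q_strictConcave.concaveOn.smul (G.scale_nonneg i s)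

lemma soloPayoff_continuousOn (i : Fin 2) (s : S) :
    ContinuousOn (G.soloPayoff i s) (Ici 0) :=
  (G.reward_continuousOn i s).sub continuousOn_id

lemma soloPayoff_zero_nonneg (i : Fin 2) (s : S) : 0 ≤ G.soloPayoff i s 0 := by
  rw [soloPayoff_eq, sub_zero]
  exact G.reward_nonneg i s le_rfl

lemma soloPayoff_le_soloPayoff_zero (i : Fin 2) (s : S) {f : ℝ} (hf : 0 ≤ f) :
    G.soloPayoff i s f ≤ G.soloPayoff 0 s f :=
  sub_le_sub_right (G.reward_le_reward_zero i s hf) f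

lemma soloPayoff_neg_of_scale_lt (i : Fin 2) (s : S) {f : ℝ} (hf : G.prize s * G.γ i < f) :
    G.soloPayoff i s f < 0 := by
  have h := G.reward_le_scale i s ((G.scale_nonneg i s).trans hf.le)
  rw [soloPayoff_eq]
  linarith

/-- The lone payoff is strictly quasiconcave in spending. -/
lemma min_lt_soloPayoff (i : Fin 2) (s : S) {a b c : ℝ} (ha : 0 ≤ a) (hab : a < b) (hbc : b < c) :
    min (G.soloPayoff i s a) (G.soloPayoff i s c) < G.soloPayoff i s b := by
  rcases (G.scale_nonneg i s).eq_or_lt with h | h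
  -- With a zero prize only the cost remains, which is still strictly decreasing.
  · refine min_lt_of_right_lt ?_
    simp only [soloPayoff, ← h, zero_mul, zero_sub]
    exact neg_lt_neg hbc
  · obtain ⟨t, u, ht, hu, htu, rfl⟩ : b ∈ openSegment ℝ a c := by
      rw [openSegment_eq_Ioo (hab.trans hbc)]
      exact ⟨hab, hbc⟩
    have hq := G.q_strictConcave.2 (mem_Ici.2 ha) (mem_Ici.2 (ha.trans (hab.trans hbc).le))
      (hab.trans hbc).ne ht hu htu
    have hq' := mul_lt_mul_of_pos_left hq h
    simp only [smul_eq_mul] at hq' ⊢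
    have h1 := mul_le_mul_of_nonneg_left
      (min_le_left (G.soloPayoff i s a) (G.soloPayoff i s c)) ht.le
    have h2 := mul_le_mul_of_nonneg_left
      (min_le_right (G.soloPayoff i s a) (G.soloPayoff i s c)) hu.le
    have h3 : t * min (G.soloPayoff i s a) (G.soloPayoff i s c) +
        u * min (G.soloPayoff i s a) (G.soloPayoff i s c) =
        min (G.soloPayoff i s a) (G.soloPayoff i s c) := by rw [← add_mul, htu, one_mul]
    simp only [soloPayoff] at *
    linarith

lemma exists_isMaxOn_soloPayoff (i : Fin 2) (s : S) :
    ∃ m, 0 ≤ m ∧ IsMaxOn (G.soloPayoff i s) (Ici 0) m := by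
  obtain ⟨m, hm, hmax⟩ := (isCompact_Icc (a := (0 : ℝ)) (b := G.prize s * G.γ i)).exists_isMaxOn
    (nonempty_Icc.2 (G.scale_nonneg i s))
    ((G.soloPayoff_continuousOn i s).mono Icc_subset_Ici_self)
  refine ⟨m, hm.1, fun f hf => ?_⟩
  rcases le_or_gt f (G.prize s * G.γ i) with h | h
  · exact hmax ⟨hf, h⟩
  · exact (G.soloPayoff_neg_of_scale_lt i s h).le.trans
      ((G.soloPayoff_zero_nonneg i s).trans (hmax (left_mem_Icc.2 (G.scale_nonneg i s))))

lemma soloPayoff_lt_of_isMaxOn (i : Fin 2) (s : S) {m x y : ℝ} (hm : 0 ≤ m)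
    (hmax : IsMaxOn (G.soloPayoff i s) (Ici 0) m) (hmx : m ≤ x) (hxy : x < y) :
    G.soloPayoff i s y < G.soloPayoff i s x := by
  have key : ∀ z, m < z → ∀ w, z < w → G.soloPayoff i s w < G.soloPayoff i s z := by
    intro z hz w hw
    have h := G.min_lt_soloPayoff i s hm hz hw
    rwa [min_eq_right (hmax (mem_Ici.2 (hm.trans (hz.trans hw).le)))] at h
  rcases hmx.eq_or_lt with rfl | hmx
  -- At the maximizer itself `key` does not apply; an intermediate point supplies the strictness.
  · obtain ⟨z, hz1, hz2⟩ := exists_between hxy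
    exact (key z hz1 y hz2).trans_le (hmax (mem_Ici.2 (hm.trans hz1.le)))
  · exact key x hmx y hxy

lemma eq_of_isMaxOn_soloPayoff (i : Fin 2) (s : S) {m x : ℝ} (hm : 0 ≤ m)
    (hmax : IsMaxOn (G.soloPayoff i s) (Ici 0) m) (hx : 0 ≤ x)
    (hxm : G.soloPayoff i s m ≤ G.soloPayoff i s x) : x = m := by
  have hmax' : IsMaxOn (G.soloPayoff i s) (Ici 0) x := fun f hf => (hmax hf).trans hxm
  rcases lt_trichotomy x m with h | h | h
  · exact absurd (G.soloPayoff_lt_of_isMaxOn i s hx hmax' le_rfl h) (not_lt.2 (hmax hx))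
  · exact h
  · exact absurd (G.soloPayoff_lt_of_isMaxOn i s hm hmax le_rfl h) (not_lt.2 hxm)

lemma optSpending_spec (i : Fin 2) (s : S) :
    0 ≤ G.optSpending i s ∧ IsMaxOn (G.soloPayoff i s) (Ici 0) (G.optSpending i s) := by
  obtain ⟨m, hm, hmax⟩ := G.exists_isMaxOn_soloPayoff i s
  have h : {f : ℝ | 0 ≤ f ∧ IsMaxOn (G.soloPayoff i s) (Ici 0) f} = {m} := by
    ext f
    refine ⟨fun hf => G.eq_of_isMaxOn_soloPayoff i s hm hmax hf.1 (hf.2 (mem_Ici.2 hm)), ?_⟩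
    rintro rfl
    exact ⟨hm, hmax⟩
  have h' : G.optSpending i s = m := by rw [optSpending, h, csSup_singleton]
  rw [h']
  exact ⟨hm, hmax⟩

lemma optSpending_nonneg (i : Fin 2) (s : S) : 0 ≤ G.optSpending i s :=
  (G.optSpending_spec i s).1

lemma soloValueAt_isGreatest (i : Fin 2) (s : S) :
    IsGreatest (G.soloPayoff i s '' Ici 0) (G.soloPayoff i s (G.optSpending i s)) := by
  obtain ⟨h0, hmax⟩ := G.optSpending_spec i s
  refine ⟨mem_image_of_mem _ h0, ?_⟩
  rintro _ ⟨f, hf, rfl⟩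
  exact hmax hf

lemma soloValueAt_eq (i : Fin 2) (s : S) :
    G.soloValueAt i s = G.soloPayoff i s (G.optSpending i s) :=
  (G.soloValueAt_isGreatest i s).csSup_eq

lemma soloPayoff_le_soloValueAt (i : Fin 2) (s : S) {f : ℝ} (hf : 0 ≤ f) :
    G.soloPayoff i s f ≤ G.soloValueAt i s := by
  rw [soloValueAt_eq]
  exact (G.optSpending_spec i s).2 hf

lemma soloPayoff_lt_of_optSpending_le (i : Fin 2) (s : S) {x y : ℝ}
    (hx : G.optSpending i s ≤ x) (hxy : x < y) : G.soloPayoff i s y < G.soloPayoff i s x :=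
  G.soloPayoff_lt_of_isMaxOn i s (G.optSpending_nonneg i s) (G.optSpending_spec i s).2 hx hxy

lemma soloValueAt_one_le_zero (s : S) : G.soloValueAt 1 s ≤ G.soloValueAt 0 s := by
  rw [G.soloValueAt_eq 1]
  exact (G.soloPayoff_le_soloPayoff_zero 1 s (G.optSpending_nonneg 1 s)).trans
    (G.soloPayoff_le_soloValueAt 0 s (G.optSpending_nonneg 1 s))

lemma soloValueAt_nonneg (i : Fin 2) (s : S) : 0 ≤ G.soloValueAt i s :=
  (G.soloPayoff_zero_nonneg i s).trans (G.soloPayoff_le_soloValueAt i s le_rfl)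

/-- Because `q ≤ 1`, break-even points are bounded by the scale of the reward; they form a compact
set, nonempty by the intermediate value theorem, so the supremum is attained. -/
lemma breakEven_isGreatest (i : Fin 2) (s : S) :
    IsGreatest {f : ℝ | 0 ≤ f ∧ G.prize s * G.γ i * G.q f = f} (G.breakEven i s) := by
  have hset : {f : ℝ | 0 ≤ f ∧ G.prize s * G.γ i * G.q f = f} =
      Icc 0 (G.prize s * G.γ i) ∩ G.soloPayoff i s ⁻¹' {0} := by
    ext f
    simp only [mem_ofPred_eq, mem_inter_iff, mem_Icc, mem_preimage, mem_singleton_iff, soloPayoff,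
      sub_eq_zero]
    refine ⟨fun ⟨h0, h⟩ => ⟨⟨h0, ?_⟩, h⟩, fun ⟨h0, h⟩ => ⟨h0.1, h⟩⟩
    rw [← h]
    exact G.reward_le_scale i s h0
  have hcont : ContinuousOn (G.soloPayoff i s) (Icc 0 (G.prize s * G.γ i)) :=
    (G.soloPayoff_continuousOn i s).mono Icc_subset_Ici_self
  have hcomp : IsCompact (Icc 0 (G.prize s * G.γ i) ∩ G.soloPayoff i s ⁻¹' {0}) :=
    isCompact_Icc.of_isClosed_subset (hcont.preimage_isClosed_of_isClosed isClosed_Icc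
      isClosed_singleton) inter_subset_left
  have hne : (Icc 0 (G.prize s * G.γ i) ∩ G.soloPayoff i s ⁻¹' {0}).Nonempty := by
    have h0 : (0 : ℝ) ∈ Icc (G.soloPayoff i s (G.prize s * G.γ i)) (G.soloPayoff i s 0) :=
      ⟨sub_nonpos.2 (G.reward_le_scale i s (G.scale_nonneg i s)), G.soloPayoff_zero_nonneg i s⟩
    obtain ⟨f, hf, hf0⟩ := intermediate_value_Icc' (G.scale_nonneg i s) hcont h0
    exact ⟨f, hf, hf0⟩
  rw [breakEven, hset]
  exact hcomp.isGreatest_sSup hne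

lemma breakEven_nonneg (i : Fin 2) (s : S) : 0 ≤ G.breakEven i s :=
  (G.breakEven_isGreatest i s).1.1

lemma soloPayoff_breakEven (i : Fin 2) (s : S) : G.soloPayoff i s (G.breakEven i s) = 0 :=
  sub_eq_zero.2 (G.breakEven_isGreatest i s).1.2

/-- A nonnegative payoff further out would have to cross zero again before the scale of the reward,
at a later break-even point. -/
lemma soloPayoff_neg_of_breakEven_lt (i : Fin 2) (s : S) {x : ℝ} (hx : G.breakEven i s < x) :
    G.soloPayoff i s x < 0 := by
  have hx0 : 0 ≤ x := (G.breakEven_nonneg i s).trans hx.le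
  by_contra! h
  have hxA : x ≤ G.prize s * G.γ i := by
    by_contra! h'
    exact absurd (G.soloPayoff_neg_of_scale_lt i s h') (not_lt.2 h)
  obtain ⟨f, hf, hf0⟩ := intermediate_value_Icc' hxA
    ((G.soloPayoff_continuousOn i s).mono (fun y hy => mem_Ici.2 (hx0.trans hy.1)))
    (show (0 : ℝ) ∈ Icc (G.soloPayoff i s (G.prize s * G.γ i)) (G.soloPayoff i s x) from
      ⟨sub_nonpos.2 (G.reward_le_scale i s (G.scale_nonneg i s)), h⟩)
  have := (G.breakEven_isGreatest i s).2 ⟨hx0.trans hf.1, sub_eq_zero.1 hf0⟩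
  linarith [hf.1]

lemma soloPayoff_nonpos_of_breakEven_le (i : Fin 2) (s : S) {x : ℝ} (hx : G.breakEven i s ≤ x) :
    G.soloPayoff i s x ≤ 0 := by
  rcases hx.eq_or_lt with rfl | hx
  · exact (G.soloPayoff_breakEven i s).le
  · exact (G.soloPayoff_neg_of_breakEven_lt i s hx).le

lemma soloPayoff_pos_of_lt_breakEven (i : Fin 2) (s : S) {x : ℝ} (h0 : 0 < x)
    (hx : x < G.breakEven i s) : 0 < G.soloPayoff i s x := by
  refine lt_of_le_of_lt ?_ (G.min_lt_soloPayoff i s le_rfl h0 hx)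
  rw [G.soloPayoff_breakEven]
  exact le_min (G.soloPayoff_zero_nonneg i s) le_rfl

/-- The spending that secures the strong attacker the contest: his optimum if it deters the weak
attacker, and the break-even spending of the weak attacker otherwise. -/
noncomputable def deterrence (s : S) : ℝ := max (G.optSpending 0 s) (G.breakEven 1 s)

lemma deterrence_nonneg (s : S) : 0 ≤ G.deterrence s :=
  (G.optSpending_nonneg 0 s).trans (le_max_left _ _)

lemma contestValueAt_eq (s : S) : G.contestValueAt s = G.soloPayoff 0 s (G.deterrence s) := by
  unfold contestValueAt deterrence
  split_ifs with h
  · rw [max_eq_right (le_of_lt h)]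
  · rw [max_eq_left (not_lt.1 h), soloValueAt_eq]

lemma contestValueAt_le_soloValueAt (s : S) : G.contestValueAt s ≤ G.soloValueAt 0 s := by
  rw [contestValueAt_eq]
  exact G.soloPayoff_le_soloValueAt 0 s (G.deterrence_nonneg s)

lemma contestValueAt_lt_soloValueAt {s : S} (h : G.Similar s) :
    G.contestValueAt s < G.soloValueAt 0 s := by
  rw [contestValueAt, if_pos h, soloValueAt_eq]
  exact G.soloPayoff_lt_of_optSpending_le 0 s le_rfl h

end AttackGame

instance (μ : MixedSpending) : IsProbabilityMeasure μ.law := μ.isProb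

/-- Spending `x` for sure. -/
noncomputable def MixedSpending.pure (x : ℝ≥0) : MixedSpending where
  law := Measure.dirac x
  isProb := inferInstance
  integrable := integrable_dirac (by simp)

/-! ### Expected payoffs in the contest. -/

namespace AttackGame

variable {S : Type*} [Fintype S] (G : AttackGame S)

/-- Expected contest payoff of `i` spending `x` for sure against `ν`. -/
noncomputable def fightPayoff (i : Fin 2) (s : S) (ν : MixedSpending) (x : ℝ≥0) : ℝ :=
  ∫ y, G.duelPayoff i s x y ∂ν.law

lemma duelExp_eq (i : Fin 2) (s : S) (μ ν : MixedSpending) :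
    G.duelExp i s μ ν = ∫ x, G.fightPayoff i s ν x ∂μ.law := rfl

lemma tie_le_one (i : Fin 2) (x : ℝ≥0) : G.tie i x ≤ 1 := by
  have h0 := G.tie_nonneg 0 x
  have h1 := G.tie_nonneg 1 x
  have h := G.tie_sum_le x
  fin_cases i <;> simp <;> linarith

lemma reward_continuous (i : Fin 2) (s : S) :
    Continuous (fun x : ℝ≥0 => G.reward i s x) :=
  (G.reward_continuousOn i s).comp_continuous NNReal.continuous_coe (fun x => x.coe_nonneg)

lemma soloPayoff_continuous (i : Fin 2) (s : S) :
    Continuous (fun x : ℝ≥0 => G.soloPayoff i s x) :=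
  (G.reward_continuous i s).sub NNReal.continuous_coe

lemma winProb_eq_indicator (i : Fin 2) (x y : ℝ≥0) :
    G.winProb i x y = (Iio x).indicator 1 y + ({x} : Set ℝ≥0).indicator (fun _ => G.tie i x) y := by
  unfold winProb
  rcases lt_trichotomy y x with h | h | h
  · simp [h, h.ne]
  · simp [h]
  · simp [h.not_gt, h.ne, h.ne']

lemma fightPayoff_eq (i : Fin 2) (s : S) (ν : MixedSpending) (x : ℝ≥0) :
    G.fightPayoff i s ν x =
      (ν.law.real (Iio x) + G.tie i x * ν.law.real {x}) * G.reward i s x - x := by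
  have h1 : Integrable ((Iio x).indicator (1 : ℝ≥0 → ℝ)) ν.law :=
    (integrable_const (1 : ℝ)).indicator measurableSet_Iio
  have h2 : Integrable (({x} : Set ℝ≥0).indicator (fun _ => G.tie i x)) ν.law :=
    (integrable_const _).indicator (measurableSet_singleton x)
  have h : ∀ y, G.duelPayoff i s x y =
      ((Iio x).indicator (1 : ℝ≥0 → ℝ) y + ({x} : Set ℝ≥0).indicator (fun _ => G.tie i x) y) *
        G.reward i s x - x := fun y => by rw [← winProb_eq_indicator]; rfl
  simp only [fightPayoff, h]
  rw [integral_sub (Integrable.mul_const (f := fun y => _ + _) (h1.add h2) _) (integrable_const _), integral_mul_const,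
    integral_add h1 h2, integral_indicator_one measurableSet_Iio,
    integral_indicator_const _ (measurableSet_singleton x)]
  simp [mul_comm]

lemma measureReal_Iio_add (ν : MixedSpending) (x : ℝ≥0) :
    ν.law.real (Iio x) + ν.law.real {x} = ν.law.real (Iic x) := by
  rw [← measureReal_union (by simp) (measurableSet_singleton x), Iio_union_right]

/-- Winning every tie bounds the payoff from above, and losing every tie (`le_fightPayoff`) from
below; through these two bounds most later arguments avoid the tie rule. -/
lemma fightPayoff_le (i : Fin 2) (s : S) (ν : MixedSpending) (x : ℝ≥0) :
    G.fightPayoff i s ν x ≤ ν.law.real (Iic x) * G.reward i s x - x := by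
  rw [fightPayoff_eq, ← measureReal_Iio_add]
  have := mul_le_of_le_one_left (measureReal_nonneg (μ := ν.law) (s := {x})) (G.tie_le_one i x)
  have h := mul_le_mul_of_nonneg_right this (G.reward_nonneg i s x.coe_nonneg)
  nlinarith

lemma le_fightPayoff (i : Fin 2) (s : S) (ν : MixedSpending) (x : ℝ≥0) :
    ν.law.real (Iio x) * G.reward i s x - x ≤ G.fightPayoff i s ν x := by
  rw [fightPayoff_eq]
  have := mul_nonneg (mul_nonneg (G.tie_nonneg i x) (measureReal_nonneg (μ := ν.law) (s := {x})))
    (G.reward_nonneg i s x.coe_nonneg)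
  nlinarith

lemma fightPayoff_le_soloPayoff (i : Fin 2) (s : S) (ν : MixedSpending) (x : ℝ≥0) :
    G.fightPayoff i s ν x ≤ G.soloPayoff i s x :=
  (G.fightPayoff_le i s ν x).trans
    (sub_le_sub_right (mul_le_of_le_one_left (G.reward_nonneg i s x.coe_nonneg) measureReal_le_one) _)

lemma fightPayoff_zero_nonneg (i : Fin 2) (s : S) (ν : MixedSpending) :
    0 ≤ G.fightPayoff i s ν 0 := by
  have h := G.le_fightPayoff i s ν 0
  simpa using h

lemma fightPayoff_measurable (i : Fin 2) (s : S) (ν : MixedSpending) :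
    Measurable (G.fightPayoff i s ν) := by
  have hw : Measurable (fun p : ℝ≥0 × ℝ≥0 => G.winProb i p.1 p.2) := by
    unfold winProb
    refine Measurable.ite (measurableSet_lt measurable_snd measurable_fst) measurable_const ?_
    exact Measurable.ite (measurableSet_eq_fun measurable_fst measurable_snd)
      ((G.tie_measurable i).comp measurable_fst) measurable_const
  have hd : Measurable (fun p : ℝ≥0 × ℝ≥0 => G.duelPayoff i s p.1 p.2) :=
    (hw.mul ((G.reward_continuous i s).measurable.comp measurable_fst)).sub
      (measurable_fst.coe_nnreal_real)
  exact (hd.stronglyMeasurable.integral_prod_right (ν := ν.law)).measurable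

lemma fightPayoff_integrable (i : Fin 2) (s : S) (μ ν : MixedSpending) :
    Integrable (G.fightPayoff i s ν) μ.law := by
  refine ((integrable_const (G.prize s * G.γ i)).add μ.integrable).mono'
    (G.fightPayoff_measurable i s ν).aestronglyMeasurable (ae_of_all _ fun x => ?_)
  rw [Real.norm_eq_abs, abs_le]
  have h1 := G.le_fightPayoff i s ν x
  have h2 := G.fightPayoff_le_soloPayoff i s ν x
  have h3 := G.reward_le_scale i s x.coe_nonneg
  have h4 := mul_nonneg (measureReal_nonneg (μ := ν.law) (s := Iio x)) (G.reward_nonneg i s x.coe_nonneg)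
  have h5 := G.scale_nonneg i s
  have h6 : (0 : ℝ) ≤ x := x.coe_nonneg
  rw [soloPayoff_eq] at h2
  simp only [Pi.add_apply]
  constructor <;> linarith

lemma soloPayoff_integrable (i : Fin 2) (s : S) (μ : MixedSpending) :
    Integrable (fun x : ℝ≥0 => G.soloPayoff i s x) μ.law := by
  refine ((integrable_const (G.prize s * G.γ i)).add μ.integrable).mono'
    (G.soloPayoff_continuous i s).aestronglyMeasurable (ae_of_all _ fun x => ?_)
  rw [Real.norm_eq_abs, abs_le, soloPayoff_eq]
  have h3 := G.reward_le_scale i s x.coe_nonneg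
  have h4 := G.reward_nonneg i s x.coe_nonneg
  have h5 := G.scale_nonneg i s
  have h6 : (0 : ℝ) ≤ x := x.coe_nonneg
  simp only [Pi.add_apply]
  constructor <;> linarith

lemma duelExp_pure (i : Fin 2) (s : S) (x : ℝ≥0) (ν : MixedSpending) :
    G.duelExp i s (.pure x) ν = G.fightPayoff i s ν x := by
  rw [duelExp_eq]
  exact integral_dirac _ x

lemma soloExp_pure (i : Fin 2) (s : S) (x : ℝ≥0) :
    G.soloExp i s (.pure x) = G.soloPayoff i s x :=
  integral_dirac _ x

lemma duelExp_le (i : Fin 2) (s : S) (μ : MixedSpending) {ν : MixedSpending} {u : ℝ}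
    (h : ∀ x, G.fightPayoff i s ν x ≤ u) : G.duelExp i s μ ν ≤ u := by
  have := integral_mono (G.fightPayoff_integrable i s μ ν) (integrable_const u) h
  simpa [duelExp_eq] using this

lemma duelExp_eq_of_ae (i : Fin 2) (s : S) {μ ν : MixedSpending} {u : ℝ}
    (h : ∀ᵐ x ∂μ.law, G.fightPayoff i s ν x = u) : G.duelExp i s μ ν = u := by
  rw [duelExp_eq, integral_congr_ae h]
  simp

lemma soloExp_le (i : Fin 2) (s : S) (μ : MixedSpending) :
    G.soloExp i s μ ≤ G.soloValueAt i s := by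
  have := integral_mono (G.soloPayoff_integrable i s μ) (integrable_const (G.soloValueAt i s))
    (fun x => G.soloPayoff_le_soloValueAt i s x.coe_nonneg)
  simpa [soloExp] using this

/-- Nobody earns more in a contest than alone. -/
lemma duelExp_le_soloValueAt (i : Fin 2) (s : S) (μ ν : MixedSpending) :
    G.duelExp i s μ ν ≤ G.soloValueAt i s :=
  G.duelExp_le i s μ fun x =>
    (G.fightPayoff_le_soloPayoff i s ν x).trans (G.soloPayoff_le_soloValueAt i s x.coe_nonneg)

/-- A profile in which each attacker's spending almost surely earns the largest payoff available
against the opponent's law is an equilibrium of the contest. -/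
lemma isContestEquilibrium_of_ae {s : S} {μ : Fin 2 → MixedSpending} (u : Fin 2 → ℝ)
    (hle : ∀ i x, G.fightPayoff i s (μ i.rev) x ≤ u i)
    (hge : ∀ i, ∀ᵐ x ∂(μ i).law, u i ≤ G.fightPayoff i s (μ i.rev) x) :
    G.IsContestEquilibrium s μ := by
  intro i ν
  rw [G.duelExp_eq_of_ae i s (μ := μ i) (u := u i)
    ((hge i).mono fun x hx => le_antisymm (hle i x) hx)]
  exact G.duelExp_le i s ν (hle i)

/-! ### Payoffs in an arbitrary contest equilibrium. -/

namespace IsContestEquilibrium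

variable {G} {s : S} {μ : Fin 2 → MixedSpending}

lemma fightPayoff_le (h : G.IsContestEquilibrium s μ) (i : Fin 2) (x : ℝ≥0) :
    G.fightPayoff i s (μ i.rev) x ≤ G.duelExp i s (μ i) (μ i.rev) := by
  rw [← duelExp_pure]
  exact h i _

lemma duelExp_nonneg (h : G.IsContestEquilibrium s μ) (i : Fin 2) :
    0 ≤ G.duelExp i s (μ i) (μ i.rev) :=
  (G.fightPayoff_zero_nonneg i s _).trans (h.fightPayoff_le i 0)

/-- No pure spending beats the equilibrium payoff, while their average under the own law equals it,
so the nonnegative shortfall vanishes almost surely. -/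
lemma ae_fightPayoff_eq (h : G.IsContestEquilibrium s μ) (i : Fin 2) :
    ∀ᵐ x ∂(μ i).law, G.fightPayoff i s (μ i.rev) x = G.duelExp i s (μ i) (μ i.rev) := by
  have hint := (integrable_const (μ := (μ i).law) (G.duelExp i s (μ i) (μ i.rev))).sub
    (G.fightPayoff_integrable i s (μ i) (μ i.rev))
  have h0 : ∫ x, (G.duelExp i s (μ i) (μ i.rev) - G.fightPayoff i s (μ i.rev) x) ∂(μ i).law = 0 := by
    rw [integral_sub (integrable_const _) (G.fightPayoff_integrable i s (μ i) (μ i.rev)),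
      ← duelExp_eq]
    simp
  have := (integral_eq_zero_iff_of_nonneg
    (fun x => sub_nonneg.2 (h.fightPayoff_le i x)) hint).1 h0
  filter_upwards [this] with x hx
  simp only [Pi.zero_apply] at hx
  linarith

/-- Spending slightly more than `x` secures what the opponent's law puts on `[0, x]`. -/
lemma measureReal_Iic_mul_le (h : G.IsContestEquilibrium s μ) (i : Fin 2) (x : ℝ≥0) :
    (μ i.rev).law.real (Iic x) * G.reward i s x - x ≤ G.duelExp i s (μ i) (μ i.rev) := by
  have hc : Continuous (fun y : ℝ≥0 => (μ i.rev).law.real (Iic x) * G.reward i s y - y) :=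
    (continuous_const.mul (G.reward_continuous i s)).sub NNReal.continuous_coe
  have ht := (hc.tendsto x).mono_left (nhdsWithin_le_nhds (s := Ioi x))
  refine le_of_tendsto ht ?_
  filter_upwards [self_mem_nhdsWithin] with y hy
  refine le_trans ?_ ((G.le_fightPayoff i s _ y).trans (h.fightPayoff_le i y))
  have hm : (μ i.rev).law.real (Iic x) ≤ (μ i.rev).law.real (Iio y) :=
    measureReal_mono (Iic_subset_Iio.2 hy)
  have := mul_le_mul_of_nonneg_right hm (G.reward_nonneg i s y.coe_nonneg)
  exact sub_le_sub_right this _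

lemma soloPayoff_le_of_ae_le (h : G.IsContestEquilibrium s μ) (i : Fin 2) {x : ℝ≥0}
    (hx : ∀ᵐ y ∂(μ i.rev).law, y ≤ x) :
    G.soloPayoff i s x ≤ G.duelExp i s (μ i) (μ i.rev) := by
  have h1 : (μ i.rev).law.real (Iic x) = 1 := by
    rw [measureReal_def, show (μ i.rev).law (Iic x) = 1 from
      (prob_compl_eq_zero_iff measurableSet_Iic).1 hx, ENNReal.toReal_one]
  have := h.measureReal_Iic_mul_le i x
  rwa [h1, one_mul] at this

end IsContestEquilibrium

end AttackGame

lemma MeasureTheory.tendsto_measureReal_Iic_nhdsGT (ν : Measure ℝ≥0) [IsFiniteMeasure ν] (x : ℝ≥0) :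
    Filter.Tendsto (fun y => ν.real (Iic y)) (nhdsWithin x (Ioi x)) (nhds (ν.real (Iic x))) := by
  have h := tendsto_measure_biInter_gt (μ := ν) (s := fun y : ℝ≥0 => Iic y) (a := x)
    (fun _ _ => measurableSet_Iic.nullMeasurableSet) (fun _ _ _ h => Iic_subset_Iic.2 h)
    ⟨x + 1, by simp, measure_ne_top _ _⟩
  have hI : ⋂ r > x, Iic r = Iic x := by
    ext z
    simp only [mem_iInter, mem_Iic]
    exact ⟨fun hz => le_of_forall_gt_imp_ge_of_dense hz, fun hz r hr => hz.trans hr.le⟩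
  rw [hI] at h
  exact (ENNReal.tendsto_toReal (measure_ne_top _ _)).comp h

namespace AttackGame

namespace IsContestEquilibrium

variable {S : Type*} [Fintype S] {G : AttackGame S} {s : S} {μ : Fin 2 → MixedSpending}

/-- If the opponent does not spend less than `l` and spends exactly `l` with positive probability,
then an attacker who spends `l` with positive probability and earns a positive payoff must win every
tie there. -/
lemma one_le_tie (h : G.IsContestEquilibrium s μ) (i : Fin 2) {l : ℝ≥0}
    (hu : 0 < G.duelExp i s (μ i) (μ i.rev)) (hl : 0 < (μ i).law {l})
    (hr : (μ i.rev).law (Iio l) = 0) : 1 ≤ G.tie i l := by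
  have hg : G.fightPayoff i s (μ i.rev) l = G.duelExp i s (μ i) (μ i.rev) := by
    by_contra hne
    refine hl.ne' (measure_mono_null ?_ (ae_iff.1 (h.ae_fightPayoff_eq i)))
    rintro x rfl
    exact hne
  have hle := h.measureReal_Iic_mul_le i l
  have hz : (μ i.rev).law.real (Iio l) = 0 := by rw [measureReal_def, hr, ENNReal.toReal_zero]
  rw [← measureReal_Iio_add, hz, zero_add] at hle
  rw [fightPayoff_eq, hz, zero_add, mul_assoc] at hg
  have hl0 := l.coe_nonneg
  have hpos : 0 < (μ i.rev).law.real {l} * G.reward i s l := by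
    refine pos_of_mul_pos_right (a := G.tie i l) (by linarith) (G.tie_nonneg i l)
  -- Losing some ties at `l` would earn strictly less there than overbidding `l` slightly.
  by_contra! hlt
  nlinarith

/-- The attackers cannot both earn a positive payoff in a contest equilibrium. -/
lemma exists_duelExp_nonpos (h : G.IsContestEquilibrium s μ) :
    ∃ i, G.duelExp i s (μ i) (μ i.rev) ≤ 0 := by
  by_contra! hu
  obtain ⟨v, hv, hvu⟩ : ∃ v > 0, ∀ i, v ≤ G.duelExp i s (μ i) (μ i.rev) :=
    ⟨_, lt_min (hu 0) (hu 1), fun i => by fin_cases i; exacts [min_le_left _ _, min_le_right _ _]⟩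
  set A := G.prize s * G.γ 0
  -- Rewards are at most `A`, so earning `v` at spending `x` requires the opponent's law to give
  -- `[0, x]` a mass which times `A` is at least `v`.
  set B : Fin 2 → Set ℝ≥0 := fun i => {x | v ≤ (μ i).law.real (Iic x) * A}
  have hB : ∀ i, ∀ᵐ x ∂(μ i).law, x ∈ B i.rev := by
    intro i
    filter_upwards [h.ae_fightPayoff_eq i] with x hx
    have h1 := G.fightPayoff_le i s (μ i.rev) x
    have h2 : (μ i.rev).law.real (Iic x) * G.reward i s x ≤ (μ i.rev).law.real (Iic x) * A :=
      mul_le_mul_of_nonneg_left ((G.reward_le_scale i s x.coe_nonneg).trans (G.scale_le s i))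
        measureReal_nonneg
    have h3 := x.coe_nonneg
    exact (hvu i).trans (by linarith)
  have hne : ∀ i, (B i).Nonempty := by
    intro i
    obtain ⟨x, hx⟩ := (hB i.rev).exists
    rw [Fin.rev_rev] at hx
    exact ⟨x, hx⟩
  have hnull : ∀ i, (μ i).law (Iio (sInf (B i.rev))) = 0 := by
    intro i
    refine measure_eq_zero_iff_ae_notMem.2 ((hB i).mono fun x hx => ?_)
    exact notMem_Iio.2 (csInf_le (OrderBot.bddBelow _) hx)
  -- Below the infimum of the opponent's set an attacker's law has no mass, so his own set cannot
  -- start earlier; by symmetry the infima agree.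
  have hle : ∀ i, sInf (B i.rev) ≤ sInf (B i) := by
    intro i
    refine le_csInf (hne i) fun x hx => ?_
    by_contra! hlt
    have : (μ i).law.real (Iic x) = 0 := by
      rw [measureReal_def, measure_mono_null (Iic_subset_Iio.2 hlt) (hnull i), ENNReal.toReal_zero]
    have hx' : v ≤ (μ i).law.real (Iic x) * A := hx
    rw [this, zero_mul] at hx'
    linarith
  have heq : ∀ i, sInf (B i.rev) = sInf (B i) := fun i =>
    le_antisymm (hle i) (by simpa using hle i.rev)
  set l := sInf (B 0)
  have hl : ∀ i, sInf (B i) = l := by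
    intro i
    fin_cases i
    · rfl
    · exact heq 0
  -- Right continuity carries the positive lower bound down to `l`, and there is no mass below `l`.
  have hatom : ∀ i, 0 < (μ i).law {l} := by
    intro i
    have hmem : v ≤ (μ i).law.real (Iic l) * A := by
      refine ge_of_tendsto
        ((tendsto_measureReal_Iic_nhdsGT (μ i).law l).mul_const A) ?_
      filter_upwards [self_mem_nhdsWithin] with y hy
      obtain ⟨z, hz, hzy⟩ := exists_lt_of_csInf_lt (hne i) ((hl i).trans_lt hy)
      have hz' : v ≤ (μ i).law.real (Iic z) * A := hz
      exact hz'.trans (mul_le_mul_of_nonneg_right (measureReal_mono (Iic_subset_Iic.2 hzy.le))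
        (G.scale_nonneg 0 s))
    have hz : (μ i).law.real (Iio l) = 0 := by
      rw [measureReal_def, ← hl i.rev, hnull i, ENNReal.toReal_zero]
    rw [← measureReal_Iio_add, hz, zero_add] at hmem
    have := pos_of_mul_pos_left (hv.trans_le hmem) (G.scale_nonneg 0 s)
    exact (ENNReal.toReal_pos_iff.1 this).1
  have htie : ∀ i, 1 ≤ G.tie i l := fun i =>
    h.one_le_tie i (hu i) (hatom i) (by rw [← hl i]; simpa using hnull i.rev)
  linarith [htie 0, htie 1, G.tie_sum_le l]

/-- Almost surely, an attacker's spending would alone earn at least the equilibrium payoff. -/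
lemma ae_le_soloPayoff (h : G.IsContestEquilibrium s μ) (i : Fin 2) :
    ∀ᵐ x : ℝ≥0 ∂(μ i).law, G.duelExp i s (μ i) (μ i.rev) ≤ G.soloPayoff i s x := by
  filter_upwards [h.ae_fightPayoff_eq i] with x hx
  rw [← hx]
  exact G.fightPayoff_le_soloPayoff i s _ x

/-- Beyond his break-even point the weak attacker loses even when he wins for sure, so his spending
almost surely does not exceed `deterrence`. -/
lemma contestValueAt_le_duelExp (h : G.IsContestEquilibrium s μ) :
    G.contestValueAt s ≤ G.duelExp 0 s (μ 0) (μ 1) := by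
  rw [contestValueAt_eq]
  refine h.soloPayoff_le_of_ae_le (i := 0) (x := ⟨G.deterrence s, G.deterrence_nonneg s⟩) ?_
  filter_upwards [h.ae_le_soloPayoff 1] with y hy
  by_contra hlt
  have hlt' : G.deterrence s < y := not_le.1 hlt
  have h1 := G.soloPayoff_neg_of_breakEven_lt 1 s ((le_max_right _ _).trans_lt hlt')
  linarith [h.duelExp_nonneg 1]

/-- If an attacker earns more than his lone payoff at the weak attacker's break-even spending, then
almost surely his spending stays below it by a margin. -/
lemma exists_ae_le_of_lt (h : G.IsContestEquilibrium s μ) (hs : G.Similar s) (i : Fin 2)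
    (hi : G.soloPayoff i s (G.breakEven 1 s) < G.duelExp i s (μ i) (μ i.rev))
    (hgt : ∀ x, G.breakEven 1 s < x → G.soloPayoff i s x ≤ G.soloPayoff i s (G.breakEven 1 s)) :
    ∃ x : ℝ≥0, 0 < x ∧ (x : ℝ) < G.breakEven 1 s ∧
      ∀ᵐ y ∂(μ i).law, y ≤ x := by
  set d : ℝ≥0 := ⟨G.breakEven 1 s, G.breakEven_nonneg 1 s⟩
  have hd : 0 < d := (G.optSpending_nonneg 0 s).trans_lt hs
  -- Continuity spreads the strict inequality `hi` to the left of `d`, which creates the margin;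
  -- beyond `d` it follows from `hgt`.
  have hev : ∀ᶠ x : ℝ≥0 in nhdsWithin d (Iio d), G.soloPayoff i s x < G.duelExp i s (μ i) (μ i.rev) :=
    (((G.soloPayoff_continuous i s).tendsto d).mono_left nhdsWithin_le_nhds).eventually_lt_const hi
  obtain ⟨a, had, ha⟩ := (mem_nhdsLT_iff_exists_Ioo_subset' hd).1 hev
  obtain ⟨x, hx1, hx2⟩ := exists_between (mem_Iio.1 had)
  refine ⟨x, pos_of_gt hx1, hx2, ?_⟩
  filter_upwards [h.ae_le_soloPayoff i] with y hy
  by_contra! hlt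
  rcases lt_trichotomy y d with hyd | rfl | hyd
  · exact absurd (ha ⟨hx1.trans hlt, hyd⟩) (not_lt.2 hy)
  · exact absurd hi (not_lt.2 hy)
  · exact absurd (hi.trans_le hy) (not_lt.2 (hgt y hyd))

/-- A weak attacker with a positive payoff would stay below his break-even point by a margin;
overbidding him there would give the strong one a positive payoff too. -/
lemma duelExp_one_eq_zero_of_similar (h : G.IsContestEquilibrium s μ) (hs : G.Similar s) :
    G.duelExp 1 s (μ 1) (μ 0) = 0 := by
  refine le_antisymm ?_ (h.duelExp_nonneg 1)
  by_contra! hpos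
  obtain ⟨x, hx0, hxd, hx⟩ := h.exists_ae_le_of_lt hs 1
    (by rwa [G.soloPayoff_breakEven]) (fun y hy => by
      rw [G.soloPayoff_breakEven]; exact (G.soloPayoff_neg_of_breakEven_lt 1 s hy).le)
  have h1 : G.soloPayoff 0 s x ≤ G.duelExp 0 s (μ 0) (μ 1) := h.soloPayoff_le_of_ae_le 0 hx
  have h2 := (G.soloPayoff_pos_of_lt_breakEven 1 s (NNReal.coe_pos.2 hx0) hxd).trans_le
    (G.soloPayoff_le_soloPayoff_zero 1 s x.coe_nonneg)
  obtain ⟨i, hi⟩ := h.exists_duelExp_nonpos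
  fin_cases i
  · exact absurd (h2.trans_le h1) (not_lt.2 hi)
  · exact absurd hpos (not_lt.2 hi)

/-- If similar, a strong attacker earning more would leave the weak one a profitable overbid below
break-even. If not, the lone value is already the upper bound. -/
lemma duelExp_zero_eq (h : G.IsContestEquilibrium s μ) :
    G.duelExp 0 s (μ 0) (μ 1) = G.contestValueAt s := by
  refine le_antisymm ?_ h.contestValueAt_le_duelExp
  by_cases hs : G.Similar s
  · by_contra! hgt
    rw [contestValueAt, if_pos hs] at hgt
    obtain ⟨x, hx0, hxd, hx⟩ := h.exists_ae_le_of_lt hs 0 hgt fun y hy =>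
      (G.soloPayoff_lt_of_optSpending_le 0 s (le_of_lt hs) hy).le
    have h1 : G.soloPayoff 1 s x ≤ G.duelExp 1 s (μ 1) (μ 0) := h.soloPayoff_le_of_ae_le 1 hx
    have h2 := G.soloPayoff_pos_of_lt_breakEven 1 s (NNReal.coe_pos.2 hx0) hxd
    linarith [h.duelExp_one_eq_zero_of_similar hs]
  · rw [contestValueAt, if_neg hs]
    exact G.duelExp_le_soloValueAt 0 s _ _

/-- Without similarity the strong attacker earns his lone maximum, hence spends its unique maximizer
almost surely. Spending less never wins, and spending as much is past the weak break-even point. -/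
lemma duelExp_one_eq_zero (h : G.IsContestEquilibrium s μ) :
    G.duelExp 1 s (μ 1) (μ 0) = 0 := by
  by_cases hs : G.Similar s
  · exact h.duelExp_one_eq_zero_of_similar hs
  have hopt : ∀ᵐ x : ℝ≥0 ∂(μ 0).law, (x : ℝ) = G.optSpending 0 s := by
    have hval : G.duelExp 0 s (μ 0) (μ 1) = G.soloPayoff 0 s (G.optSpending 0 s) := by
      rw [h.duelExp_zero_eq, contestValueAt, if_neg hs, soloValueAt_eq]
    filter_upwards [h.ae_le_soloPayoff 0] with x hx
    obtain ⟨h0, hmax⟩ := G.optSpending_spec 0 s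
    exact G.eq_of_isMaxOn_soloPayoff 0 s h0 hmax x.coe_nonneg (hval.symm.trans_le hx)
  refine le_antisymm (G.duelExp_le 1 s _ fun y => ?_) (h.duelExp_nonneg 1)
  rcases lt_or_ge (y : ℝ) (G.optSpending 0 s) with hy | hy
  · have hz : (μ 0).law.real (Iic y) = 0 := by
      rw [measureReal_def, measure_eq_zero_iff_ae_notMem.2 (hopt.mono fun x hx => ?_),
        ENNReal.toReal_zero]
      exact notMem_Iic.2 (NNReal.coe_lt_coe.1 (hx ▸ hy))
    have := G.fightPayoff_le 1 s (μ 0) y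
    rw [hz, zero_mul, zero_sub] at this
    exact this.trans (neg_nonpos.2 y.coe_nonneg)
  · exact (G.fightPayoff_le_soloPayoff 1 s _ y).trans
      (G.soloPayoff_nonpos_of_breakEven_le 1 s ((not_lt.1 hs).trans hy))

end IsContestEquilibrium

end AttackGame

/-! ### Construction of contest equilibria. -/

open Filter Topology Function in
/-- A monotone function from `[0, ∞)` to `[0, 1]` that equals `1` from `d` on is, up to its values
at jumps, the distribution function of a law of spending. -/
lemma MixedSpending.exists_of_monotone {R : ℝ≥0 → ℝ} (hR : Monotone R) (h0 : 0 ≤ R 0) {d : ℝ≥0}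
    (hd : ∀ x, d ≤ x → R x = 1) :
    ∃ ν : MixedSpending, (∀ x, ν.law.real (Iic x) = rightLim R x) ∧
      (∀ x, 0 < x → ν.law.real (Iio x) = leftLim R x) ∧ ν.law (Ioi d) = 0 := by
  set F := hR.stieltjesFunction
  have hF : ∀ x, F x = rightLim R x := fun x => rfl
  have hF0 : 0 ≤ F 0 := h0.trans (hR.le_rightLim le_rfl)
  have hFd : ∀ x, d ≤ x → F x = 1 := fun x hx => le_antisymm
    ((hR.rightLim_le (lt_add_one x)).trans_eq (hd _ (hx.trans (lt_add_one x).le)))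
    ((hd x hx).symm.trans_le (hR.le_rightLim le_rfl))
  have hbot : Tendsto F atBot (𝓝 (F 0)) := by
    rw [atBot_eq_pure_of_isBot isBot_bot]
    exact tendsto_pure_nhds F 0
  have htop : Tendsto F atTop (𝓝 1) :=
    tendsto_const_nhds.congr' ((eventually_ge_atTop d).mono fun x hx => (hFd x hx).symm)
  have hF1 : F 0 ≤ 1 := (F.mono (zero_le (a := d))).trans_eq (hFd d le_rfl)
  -- The Stieltjes measure sees only increments of `F`; the mass at the bottom point is added by
  -- hand.
  set L : Measure ℝ≥0 := ENNReal.ofReal (F 0) • Measure.dirac 0 + F.measure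
  have hIic : ∀ x, L (Iic x) = ENNReal.ofReal (F x) := by
    intro x
    rw [Measure.add_apply, Measure.smul_apply, F.measure_Iic hbot,
      Measure.dirac_apply' _ measurableSet_Iic]
    simp only [mem_Iic, zero_le, indicator_of_mem, Pi.one_apply, smul_eq_mul, mul_one]
    rw [← ENNReal.ofReal_add hF0 (sub_nonneg.2 (F.mono zero_le)), add_sub_cancel]
  have hIio : ∀ x, 0 < x → L (Iio x) = ENNReal.ofReal (leftLim R x) := by
    intro x hx
    have : (𝓝[<] x).NeBot := nhdsLT_neBot_of_exists_lt ⟨0, hx⟩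
    have hlim : leftLim F x = leftLim R x := leftLim_rightLim (hR.tendsto_leftLim x)
    have hle : F 0 ≤ leftLim R x := hR.rightLim_le_leftLim hx
    rw [Measure.add_apply, Measure.smul_apply, F.measure_Iio hbot, hlim,
      Measure.dirac_apply' _ measurableSet_Iio]
    simp only [mem_Iio, hx, indicator_of_mem, Pi.one_apply, smul_eq_mul, mul_one]
    rw [← ENNReal.ofReal_add hF0 (sub_nonneg.2 hle), add_sub_cancel]
  have hIoi : L (Ioi d) = 0 := by
    rw [Measure.add_apply, Measure.smul_apply, F.measure_Ioi htop,
      Measure.dirac_apply' _ measurableSet_Ioi, hFd d le_rfl]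
    simp
  have hprob : IsProbabilityMeasure L := by
    refine ⟨?_⟩
    rw [← Iic_union_Ioi (a := d), measure_union (by simp) measurableSet_Ioi, hIic, hIoi,
      hFd d le_rfl]
    simp
  have hint : Integrable (fun x : ℝ≥0 => (x : ℝ)) L := by
    refine (integrable_const (d : ℝ)).mono' NNReal.continuous_coe.aestronglyMeasurable ?_
    filter_upwards [measure_eq_zero_iff_ae_notMem.1 hIoi] with x hx
    rw [Real.norm_of_nonneg x.coe_nonneg]
    exact NNReal.coe_le_coe.2 (notMem_Ioi.1 hx)
  refine ⟨⟨L, hprob, hint⟩, fun x => ?_, fun x hx => ?_, hIoi⟩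
  · rw [measureReal_def, hIic, ENNReal.toReal_ofReal (hF0.trans (F.mono zero_le)), hF]
  · rw [measureReal_def, hIio x hx,
      ENNReal.toReal_ofReal (hF0.trans (hR.rightLim_le_leftLim hx))]

namespace AttackGame

variable {S : Type*} [Fintype S] (G : AttackGame S)

/-- The bound with all ties won is a limit from the right of values of the curve, so the values of
`R` at jumps and the tie rule are irrelevant. -/
lemma fightPayoff_le_of_forall {i : Fin 2} {s : S} {ν : MixedSpending} {R : ℝ≥0 → ℝ}
    (hR : Monotone R) {u : ℝ} (h : ∀ y : ℝ≥0, R y * G.reward i s y - y ≤ u) {x : ℝ≥0}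
    (hν : ν.law.real (Iic x) = Function.rightLim R x) : G.fightPayoff i s ν x ≤ u := by
  refine (G.fightPayoff_le i s ν x).trans ?_
  rw [hν]
  refine le_of_tendsto (((hR.tendsto_rightLim x).mul
    (((G.reward_continuous i s).tendsto x).mono_left nhdsWithin_le_nhds)).sub
    ((NNReal.continuous_coe.tendsto x).mono_left nhdsWithin_le_nhds)) (.of_forall h)

lemma le_fightPayoff_of_eventually {i : Fin 2} {s : S} {ν : MixedSpending} {R : ℝ≥0 → ℝ}
    (hR : Monotone R) {u : ℝ} {x : ℝ≥0} (hx : 0 < x)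
    (h : ∀ᶠ y : ℝ≥0 in nhdsWithin x (Iio x), u ≤ R y * G.reward i s y - y)
    (hν : ν.law.real (Iio x) = Function.leftLim R x) : u ≤ G.fightPayoff i s ν x := by
  refine le_trans ?_ (G.le_fightPayoff i s ν x)
  rw [hν]
  have : (nhdsWithin x (Iio x)).NeBot := nhdsLT_neBot_of_exists_lt ⟨0, hx⟩
  exact ge_of_tendsto (((hR.tendsto_leftLim x).mul
    (((G.reward_continuous i s).tendsto x).mono_left nhdsWithin_le_nhds)).sub
    ((NNReal.continuous_coe.tendsto x).mono_left nhdsWithin_le_nhds)) h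

/-- Scaling the reward down until the best net payoff on `[0, d]` is `u`. -/
lemma exists_scale_touching (i : Fin 2) (s : S) {u : ℝ} (hu : 0 ≤ u) {d : ℝ≥0}
    (hd : G.soloPayoff i s d = u) :
    ∃ m ∈ Icc (0 : ℝ) 1, ∃ a ≤ d, m * G.reward i s a - a = u ∧
      ∀ y : ℝ≥0, y ≤ d → m * G.reward i s y - y ≤ u := by
  set K : Set (ℝ × ℝ≥0) := (Icc 0 1 ×ˢ Icc 0 d) ∩ {p | u ≤ p.1 * G.reward i s p.2 - p.2}
  have hc : Continuous (fun p : ℝ × ℝ≥0 => p.1 * G.reward i s p.2 - p.2) :=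
    (continuous_fst.mul ((G.reward_continuous i s).comp continuous_snd)).sub
      (NNReal.continuous_coe.comp continuous_snd)
  have hK : IsCompact K := (isCompact_Icc.prod isCompact_Icc).inter_right
    (isClosed_le continuous_const hc)
  have hne : K.Nonempty := by
    refine ⟨(1, d), ⟨⟨by simp, by simp⟩, ?_⟩⟩
    show u ≤ 1 * G.reward i s d - d
    rw [one_mul, ← soloPayoff_eq, hd]
  obtain ⟨⟨m, a⟩, ⟨⟨hm, ha⟩, hma⟩, hmin⟩ := hK.exists_isMinOn hne continuous_fst.continuousOn
  have hma' : u ≤ m * G.reward i s a - a := hma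
  have key : ∀ y : ℝ≥0, y ≤ d → m * G.reward i s y - y ≤ u := by
    intro y hy
    by_contra! hlt
    have hy0 := y.coe_nonneg
    have hpos : 0 < G.reward i s y := pos_of_mul_pos_right (a := m) (by linarith) hm.1
    -- The scale at which `y` nets exactly `u` would be smaller than the minimal `m`.
    have hmem : ((u + y) / G.reward i s y, y) ∈ K := by
      refine ⟨⟨⟨by positivity, ?_⟩, ⟨zero_le, hy⟩⟩, ?_⟩
      · refine ((div_le_iff₀ hpos).2 ?_).trans hm.2
        linarith
      · show u ≤ (u + y) / G.reward i s y * G.reward i s y - y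
        rw [div_mul_cancel₀ _ hpos.ne']
        linarith
    have hle : m ≤ (u + y) / G.reward i s y := hmin hmem
    rw [le_div_iff₀ hpos] at hle
    linarith
  exact ⟨m, hm, a, ha.2, le_antisymm (key a ha.2) hma', key⟩

/-- Past a point where it does not increase, a scaled net payoff does not increase. -/
lemma scaled_le_of_le (i : Fin 2) (s : S) {ρ : ℝ} (hρ : 0 ≤ ρ) {a x y : ℝ≥0} (hax : a < x)
    (hxy : x < y) (h : ρ * G.reward i s x - x ≤ ρ * G.reward i s a - a) :
    ρ * G.reward i s y - y ≤ ρ * G.reward i s x - x := by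
  have hc : ConcaveOn ℝ (Ici 0) (fun f => ρ * G.reward i s f - f) :=
    ((G.reward_concaveOn i s).smul hρ).sub (convexOn_id (convex_Ici 0))
  have hs := hc.slope_anti_adjacent (mem_Ici.2 a.coe_nonneg) (mem_Ici.2 y.coe_nonneg)
    (NNReal.coe_lt_coe.2 hax) (NNReal.coe_lt_coe.2 hxy)
  have h1 : (0 : ℝ) < x - a := sub_pos.2 (NNReal.coe_lt_coe.2 hax)
  have h2 : (0 : ℝ) < y - x := sub_pos.2 (NNReal.coe_lt_coe.2 hxy)
  have h3 := hs.trans (div_nonpos_of_nonpos_of_nonneg (sub_nonpos.2 h) h1.le)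
  rw [div_le_iff₀ h2, zero_mul] at h3
  exact sub_nonpos.1 h3

/-- The average reward `reward / spending` is nonincreasing. -/
lemma mul_reward_le_mul_reward (i : Fin 2) (s : S) {x y : ℝ≥0} (hxy : x ≤ y) :
    x * G.reward i s y ≤ y * G.reward i s x := by
  rcases (zero_le (a := y)).eq_or_lt with rfl | hy
  · simp [le_antisymm hxy zero_le]
  have hy' : (0 : ℝ) < y := NNReal.coe_pos.2 hy
  have ht : (x : ℝ) / y ≤ 1 := (div_le_one hy').2 (NNReal.coe_le_coe.2 hxy)
  have h := (G.reward_concaveOn i s).2 (mem_Ici.2 y.coe_nonneg) (mem_Ici.2 le_rfl)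
    (div_nonneg x.coe_nonneg y.coe_nonneg) (sub_nonneg.2 ht) (add_sub_cancel _ _)
  have h0 := mul_nonneg (sub_nonneg.2 ht) (G.reward_nonneg i s le_rfl)
  simp only [smul_eq_mul, mul_zero, add_zero, div_mul_cancel₀ _ hy'.ne'] at h
  have h1 : (x : ℝ) / y * G.reward i s y ≤ G.reward i s x := by linarith
  rwa [div_mul_eq_mul_div, div_le_iff₀ hy', mul_comm _ (y : ℝ)] at h1

lemma Similar.breakEven_pos {G : AttackGame S} {s : S} (hs : G.Similar s) : 0 < G.breakEven 1 s :=
  (G.optSpending_nonneg 0 s).trans_lt hs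

lemma Similar.reward_pos {G : AttackGame S} {s : S} (hs : G.Similar s) (i : Fin 2) {x : ℝ≥0}
    (hx : 0 < x) : 0 < G.reward i s x := by
  have hp : 0 < G.prize s := by
    refine (G.prize_nonneg s).lt_of_ne fun h => ?_
    have h1 := (G.breakEven_isGreatest 1 s).1.2
    rw [← h, zero_mul, zero_mul] at h1
    exact hs.breakEven_pos.ne h1
  have hx' : (0 : ℝ) < x := NNReal.coe_pos.2 hx
  exact mul_pos (mul_pos hp (G.γ_pos i)) ((G.q_mem 0 le_rfl).1.trans_lt
    (G.q_strictMono (mem_Ici.2 le_rfl) (mem_Ici.2 hx'.le) hx'))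

end AttackGame

namespace AttackGame

variable {S : Type*} [Fintype S] {G : AttackGame S}

/-- The spending law of the weak attacker against which the strong attacker earns at most `u`, and
exactly `u` from `a` to `d`. -/
lemma Similar.exists_law_one {s : S} (hs : G.Similar s) {u m : ℝ} {a d : ℝ≥0}
    (hd : G.soloPayoff 0 s d = u) (hopt : G.optSpending 0 s ≤ d) (hd0 : 0 < d)
    (hm : m ∈ Icc (0 : ℝ) 1) (had : a ≤ d) (ha : m * G.reward 0 s a - a = u)
    (hma : ∀ y : ℝ≥0, y ≤ d → m * G.reward 0 s y - y ≤ u) :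
    ∃ ν : MixedSpending, (∀ x, G.fightPayoff 0 s ν x ≤ u) ∧
      (∀ x, 0 < x → a ≤ x → x ≤ d → u ≤ G.fightPayoff 0 s ν x) ∧
      ν.law (Ioc 0 a) = 0 ∧ ν.law (Ioi d) = 0 := by
  set r : ℝ≥0 → ℝ := fun z => (u + z) / G.reward 0 s z
  have hr : ∀ z, 0 < z → r z * G.reward 0 s z - z = u := by
    intro z hz
    rw [div_mul_cancel₀ _ (hs.reward_pos 0 hz).ne', add_sub_cancel_right]
  have hmr : ∀ z, 0 < z → z ≤ d → m ≤ r z := by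
    intro z hz hzd
    rw [le_div_iff₀ (hs.reward_pos 0 hz)]
    linarith [hma z hzd]
  have hrd : r d = 1 := by
    rw [div_eq_one_iff_eq (hs.reward_pos 0 hd0).ne', ← hd, soloPayoff_eq, sub_add_cancel]
  have hrmono : ∀ z z', 0 < z → a < z → z ≤ z' → z' ≤ d → r z ≤ r z' := by
    intro z z' hz haz hzz hzd
    rcases hzz.eq_or_lt with rfl | hzz
    · exact le_rfl
    -- At the fixed scale `r z` the net payoff is `u` at `z` and at least `u` at `a`, so by
    -- concavity it is at most `u` at `z'`; hence `z'` needs a scale at least `r z`.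
    have hmz := hmr z hz (hzz.le.trans hzd)
    have h1 : r z * G.reward 0 s z - z ≤ r z * G.reward 0 s a - a := by
      rw [hr z hz, ← ha]
      exact sub_le_sub_right
        (mul_le_mul_of_nonneg_right hmz (G.reward_nonneg 0 s a.coe_nonneg)) _
    have h2 := G.scaled_le_of_le 0 s (hm.1.trans hmz) haz hzz h1
    rw [hr z hz] at h2
    rw [le_div_iff₀ (hs.reward_pos 0 (hz.trans hzz))]
    linarith
  set R : ℝ≥0 → ℝ := fun x => if x ≤ a then m else r (min x d)
  have hRle : ∀ x, x ≤ a → R x = m := fun x hx => if_pos hx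
  have hRgt : ∀ x, a < x → R x = r (min x d) := fun x hx => if_neg (not_le.2 hx)
  have hRmono : Monotone R := by
    intro x y hxy
    rcases le_or_gt y a with hya | hya
    · rw [hRle x (hxy.trans hya), hRle y hya]
    have hy0 : 0 < min y d := lt_min (zero_le.trans_lt hya) hd0
    rw [hRgt y hya]
    rcases le_or_gt x a with hxa | hxa
    · rw [hRle x hxa]
      exact hmr _ hy0 (min_le_right _ _)
    rw [hRgt x hxa]
    have hx0 : 0 < min x d := lt_min (zero_le.trans_lt hxa) hd0
    rcases had.eq_or_lt with rfl | had
    · rw [min_eq_right hxa.le, min_eq_right hya.le]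
    · exact hrmono _ _ hx0 (lt_min hxa had) (min_le_min_right d hxy) (min_le_right _ _)
  have hR1 : ∀ x, d ≤ x → R x = 1 := by
    intro x hx
    rcases le_or_gt x a with hxa | hxa
    · obtain rfl : a = d := le_antisymm had (hx.trans hxa)
      rw [hRle x hxa]
      have h1 := hs.reward_pos 0 hd0
      rw [soloPayoff_eq] at hd
      refine mul_right_cancel₀ h1.ne' ?_
      linarith
    · rw [hRgt x hxa, min_eq_right hx, hrd]
  have hRu : ∀ y : ℝ≥0, R y * G.reward 0 s y - y ≤ u := by
    intro y
    rcases le_or_gt d y with hdy | hdy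
    · rw [hR1 y hdy, one_mul, ← soloPayoff_eq, ← hd]
      rcases hdy.eq_or_lt with rfl | hdy
      · exact le_rfl
      · exact (G.soloPayoff_lt_of_optSpending_le 0 s hopt hdy).le
    rcases le_or_gt y a with hya | hya
    · rw [hRle y hya]
      exact hma y hdy.le
    · rw [hRgt y hya, min_eq_left hdy.le, hr y (zero_le.trans_lt hya)]
  obtain ⟨ν, hIic, hIio, hIoi⟩ := MixedSpending.exists_of_monotone hRmono
    (hm.1.trans_eq (hRle 0 zero_le).symm) hR1
  refine ⟨ν, fun x => G.fightPayoff_le_of_forall hRmono hRu (hIic x), fun x hx0 hax hxd => ?_, ?_,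
    hIoi⟩
  · rcases hax.eq_or_lt with rfl | hax
    -- At `a` the mass strictly below is at least `m`, so `u` is earned without winning ties.
    · refine le_trans ?_ (G.le_fightPayoff 0 s ν a)
      rw [hIio a hx0, ← ha]
      refine sub_le_sub_right (mul_le_mul_of_nonneg_right ?_
        (G.reward_nonneg 0 s a.coe_nonneg)) _
      rw [← hRle 0 zero_le]
      exact hRmono.le_leftLim hx0
    · refine G.le_fightPayoff_of_eventually hRmono hx0 ?_ (hIio x hx0)
      filter_upwards [Ioo_mem_nhdsLT hax] with y hy
      rw [hRgt y hy.1, min_eq_left (hy.2.le.trans hxd), hr y (zero_le.trans_lt hy.1)]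
  · rcases (zero_le (a := a)).eq_or_lt with rfl | ha0
    · simp
    -- The upper bound `u` caps the mass of `[0, a]` at `m`, and zero alone already carries `m`.
    have h1 : ν.law.real (Iic a) ≤ m := by
      rw [hIic]
      have h := le_of_tendsto (f := fun y : ℝ≥0 => R y * G.reward 0 s y - y)
        (((hRmono.tendsto_rightLim a).mul
        (((G.reward_continuous 0 s).tendsto a).mono_left nhdsWithin_le_nhds)).sub
        ((NNReal.continuous_coe.tendsto a).mono_left nhdsWithin_le_nhds)) (.of_forall hRu)
      rw [← ha] at h
      exact le_of_mul_le_mul_right (by linarith) (hs.reward_pos 0 ha0)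
    have h2 : m ≤ ν.law.real (Iic 0) := by
      rw [hIic, ← hRle 0 zero_le]
      exact hRmono.le_rightLim le_rfl
    have h3 : ν.law.real (Ioc 0 a) = ν.law.real (Iic a) - ν.law.real (Iic 0) := by
      rw [← measureReal_sdiff (Iic_subset_Iic.2 zero_le) measurableSet_Iic, Iic_sdiff_Iic]
    have h4 : ν.law.real (Ioc 0 a) = 0 := le_antisymm (by linarith) measureReal_nonneg
    exact (measureReal_eq_zero_iff).1 h4

/-- The spending law of the strong attacker, on `[a, d]`, against which the weak attacker breaks
even. -/
lemma Similar.exists_law_zero {s : S} (hs : G.Similar s) {a d : ℝ≥0}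
    (hd : G.breakEven 1 s = d) (had : a ≤ d) :
    ∃ ν : MixedSpending, (∀ x, G.fightPayoff 1 s ν x ≤ 0) ∧
      (∀ x, a < x → x ≤ d → 0 ≤ G.fightPayoff 1 s ν x) ∧
      ν.law (Iio a) = 0 ∧ ν.law (Ioi d) = 0 ∧ (0 < G.reward 1 s 0 → ν.law {0} = 0) := by
  have hd0 : 0 < d := NNReal.coe_pos.1 (hd ▸ hs.breakEven_pos)
  set r : ℝ≥0 → ℝ := fun z => z / G.reward 1 s z
  have hr : ∀ z, r z * G.reward 1 s z - z = 0 := by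
    intro z
    rcases (zero_le (a := z)).eq_or_lt with rfl | hz
    · simp [r]
    · rw [div_mul_cancel₀ _ (hs.reward_pos 1 hz).ne', sub_self]
  have hr0 : ∀ z, 0 ≤ r z := fun z => div_nonneg z.coe_nonneg (G.reward_nonneg 1 s z.coe_nonneg)
  have hrmono : Monotone r := by
    intro z z' hzz
    rcases (zero_le (a := z)).eq_or_lt with rfl | hz
    · simpa [r] using hr0 z'
    · rw [div_le_div_iff₀ (hs.reward_pos 1 hz) (hs.reward_pos 1 (hz.trans_le hzz))]
      exact G.mul_reward_le_mul_reward 1 s hzz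
  have hrd : r d = 1 := by
    rw [div_eq_one_iff_eq (hs.reward_pos 1 hd0).ne', ← hd]
    exact (G.breakEven_isGreatest 1 s).1.2.symm
  -- The mass that `r` assigns to `[0, a]` is moved to an atom at `a`.
  set R : ℝ≥0 → ℝ := fun x => if x < a then 0 else r (min x d)
  have hRlt : ∀ x, x < a → R x = 0 := fun x hx => if_pos hx
  have hRge : ∀ x, a ≤ x → R x = r (min x d) := fun x hx => if_neg (not_lt.2 hx)
  have hRmono : Monotone R := by
    intro x y hxy
    rcases lt_or_ge x a with hxa | hxa
    · rw [hRlt x hxa]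
      rcases lt_or_ge y a with hya | hya
      · rw [hRlt y hya]
      · rw [hRge y hya]
        exact hr0 _
    · rw [hRge x hxa, hRge y (hxa.trans hxy)]
      exact hrmono (min_le_min_right d hxy)
  have hR1 : ∀ x, d ≤ x → R x = 1 := by
    intro x hx
    rw [hRge x (had.trans hx), min_eq_right hx, hrd]
  have hR0 : 0 ≤ R 0 := by
    rcases lt_or_ge 0 a with h | h
    · rw [hRlt 0 h]
    · rw [hRge 0 h]
      exact hr0 _
  have hRu : ∀ y : ℝ≥0, R y * G.reward 1 s y - y ≤ 0 := by
    intro y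
    rcases le_or_gt d y with hdy | hdy
    · rw [hR1 y hdy, one_mul, ← soloPayoff_eq]
      exact G.soloPayoff_nonpos_of_breakEven_le 1 s (hd.trans_le (NNReal.coe_le_coe.2 hdy))
    rcases lt_or_ge y a with hya | hya
    · rw [hRlt y hya, zero_mul, zero_sub]
      exact neg_nonpos.2 y.coe_nonneg
    · rw [hRge y hya, min_eq_left hdy.le, hr y]
  obtain ⟨ν, hIic, hIio, hIoi⟩ := MixedSpending.exists_of_monotone hRmono hR0 hR1
  refine ⟨ν, fun x => G.fightPayoff_le_of_forall hRmono hRu (hIic x), fun x hax hxd => ?_, ?_,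
    hIoi, fun h0 => ?_⟩
  · have hx0 : 0 < x := zero_le.trans_lt hax
    refine G.le_fightPayoff_of_eventually hRmono hx0 ?_ (hIio x hx0)
    filter_upwards [Ioo_mem_nhdsLT hax] with y hy
    rw [hRge y hy.1.le, min_eq_left (hy.2.le.trans hxd), hr y]
  · rcases (zero_le (a := a)).eq_or_lt with rfl | ha0
    · simp
    refine (measureReal_eq_zero_iff).1 (le_antisymm ?_ measureReal_nonneg)
    rw [hIio a ha0]
    have : (nhdsWithin a (Iio a)).NeBot := nhdsLT_neBot_of_exists_lt ⟨0, ha0⟩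
    refine le_of_tendsto (hRmono.tendsto_leftLim a) ?_
    filter_upwards [self_mem_nhdsWithin] with y hy
    exact (hRlt y hy).le
  · have h1 : (Iic 0 : Set ℝ≥0) = {0} := by
      ext x
      simp
    refine (measureReal_eq_zero_iff).1 (le_antisymm ?_ measureReal_nonneg)
    rw [← h1, hIic]
    have h := le_of_tendsto (f := fun y : ℝ≥0 => R y * G.reward 1 s y - y)
      (((hRmono.tendsto_rightLim 0).mul
      (((G.reward_continuous 1 s).tendsto 0).mono_left nhdsWithin_le_nhds)).sub
      ((NNReal.continuous_coe.tendsto 0).mono_left nhdsWithin_le_nhds)) (.of_forall hRu)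
    rw [NNReal.coe_zero, sub_zero] at h
    exact nonpos_of_mul_nonpos_left h h0

lemma Similar.exists_isContestEquilibrium {s : S} (hs : G.Similar s) :
    ∃ μ, G.IsContestEquilibrium s μ := by
  obtain ⟨d, hd⟩ : ∃ d : ℝ≥0, G.breakEven 1 s = d := ⟨⟨_, G.breakEven_nonneg 1 s⟩, rfl⟩
  have hd0 : 0 < d := NNReal.coe_pos.1 (hd ▸ hs.breakEven_pos)
  have hopt : G.optSpending 0 s ≤ d := hd ▸ le_of_lt hs
  obtain ⟨u, hdu⟩ : ∃ u, G.soloPayoff 0 s d = u := ⟨_, rfl⟩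
  have hu : 0 ≤ u := by
    rw [← hdu, ← hd, ← G.soloPayoff_breakEven 1 s]
    exact G.soloPayoff_le_soloPayoff_zero 1 s (G.breakEven_nonneg 1 s)
  obtain ⟨m, hm, a, had, ha, hma⟩ := G.exists_scale_touching 0 s hu hdu
  obtain ⟨ν₁, h1le, h1ge, h1a, h1d⟩ := hs.exists_law_one hdu hopt hd0 hm had ha hma
  obtain ⟨ν₀, h0le, h0ge, h0a, h0d, h00⟩ := hs.exists_law_zero hd had
  refine ⟨![ν₀, ν₁], isContestEquilibrium_of_ae G ![u, 0] ?_ ?_⟩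
  · intro i x
    fin_cases i
    · exact h1le x
    · exact h0le x
  · intro i
    fin_cases i
    · show ∀ᵐ x ∂ν₀.law, u ≤ G.fightPayoff 0 s ν₁ x
      have hzero : ∀ᵐ x ∂ν₀.law, x = 0 → G.reward 1 s 0 = 0 := by
        rcases (G.reward_nonneg 1 s le_rfl).eq_or_lt with h | h
        · exact .of_forall fun _ _ => h.symm
        · filter_upwards [measure_eq_zero_iff_ae_notMem.1 (h00 h)] with x hx hx0
          exact absurd hx0 hx
      filter_upwards [measure_eq_zero_iff_ae_notMem.1 h0a, measure_eq_zero_iff_ae_notMem.1 h0d,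
        hzero] with x hxa hxd hx0
      -- The strong attacker can have an atom at zero only if `q 0 = 0`; then `a = 0` gives `u = 0`,
      -- and ties at zero do not matter.
      rcases (zero_le (a := x)).eq_or_lt with rfl | hx
      · have hq : G.q 0 = 0 := by
          have hpos := hs.reward_pos 1 hd0
          have hne : G.prize s * G.γ 1 ≠ 0 := left_ne_zero_of_mul hpos.ne'
          exact (mul_eq_zero.1 (hx0 rfl)).resolve_left hne
        obtain rfl : a = 0 := le_antisymm (notMem_Iio.1 hxa) zero_le
        have hu0 : u = 0 := by
          rw [← ha]
          simp [reward, hq]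
        rw [hu0]
        exact G.fightPayoff_zero_nonneg 0 s ν₁
      · exact h1ge x hx (notMem_Iio.1 hxa) (notMem_Ioi.1 hxd)
    · show ∀ᵐ x ∂ν₁.law, 0 ≤ G.fightPayoff 1 s ν₀ x
      filter_upwards [measure_eq_zero_iff_ae_notMem.1 h1a, measure_eq_zero_iff_ae_notMem.1 h1d]
        with x hxa hxd
      rcases (zero_le (a := x)).eq_or_lt with rfl | hx
      · exact G.fightPayoff_zero_nonneg 1 s ν₀
      · exact h0ge x (not_le.1 fun h => hxa ⟨hx, h⟩) (notMem_Ioi.1 hxd)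

lemma exists_isContestEquilibrium_of_not_similar {s : S} (hs : ¬ G.Similar s) :
    ∃ μ, G.IsContestEquilibrium s μ := by
  set m : ℝ≥0 := ⟨G.optSpending 0 s, G.optSpending_nonneg 0 s⟩
  have hms : G.soloPayoff 0 s m = G.soloValueAt 0 s := (G.soloValueAt_eq 0 s).symm
  have hbe : G.breakEven 1 s ≤ m := not_lt.1 hs
  refine ⟨![.pure m, .pure 0], isContestEquilibrium_of_ae G ![G.soloValueAt 0 s, 0] ?_ ?_⟩
  · intro i x
    fin_cases i
    · exact (G.fightPayoff_le_soloPayoff 0 s _ x).trans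
        (G.soloPayoff_le_soloValueAt 0 s x.coe_nonneg)
    · show G.fightPayoff 1 s (.pure m) x ≤ 0
      rcases lt_or_ge x m with hx | hx
      · refine (G.fightPayoff_le 1 s _ x).trans ?_
        have h0 : (MixedSpending.pure m).law.real (Iic x) = 0 := by
          rw [measureReal_def, MixedSpending.pure, Measure.dirac_apply' _ measurableSet_Iic]
          simp [hx]
        rw [h0, zero_mul, zero_sub]
        exact neg_nonpos.2 x.coe_nonneg
      · exact (G.fightPayoff_le_soloPayoff 1 s _ x).trans
          (G.soloPayoff_nonpos_of_breakEven_le 1 s (hbe.trans (NNReal.coe_le_coe.2 hx)))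
  · intro i
    fin_cases i
    · show ∀ᵐ x ∂(MixedSpending.pure m).law, G.soloValueAt 0 s ≤ G.fightPayoff 0 s (.pure 0) x
      have : ∀ᵐ x ∂(MixedSpending.pure m).law, x = m := by
        rw [MixedSpending.pure, ae_dirac_eq]
        exact rfl
      filter_upwards [this] with x hx
      rw [hx, ← hms]
      rcases (zero_le (a := m)).eq_or_lt with h0 | h0
      -- If the optimum is zero, so is the weak break-even point; then the prize or `q 0` vanishes,
      -- and the lone value to be matched is zero.
      · rw [← h0]
        refine le_trans (le_of_eq ?_) (G.fightPayoff_zero_nonneg 0 s _)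
        have hb0 : G.breakEven 1 s = 0 :=
          le_antisymm (hbe.trans_eq (by rw [← h0, NNReal.coe_zero])) (G.breakEven_nonneg 1 s)
        have h1 := (G.breakEven_isGreatest 1 s).1.2
        rw [hb0] at h1
        rcases mul_eq_zero.1 h1 with h | h
        · have := (mul_eq_zero.1 h).resolve_right (G.γ_pos 1).ne'
          simp [soloPayoff, this]
        · simp [soloPayoff, h]
      · refine le_trans (le_of_eq ?_) (G.le_fightPayoff 0 s _ m)
        have h1 : (MixedSpending.pure 0).law.real (Iio m) = 1 := by
          rw [measureReal_def, MixedSpending.pure, Measure.dirac_apply' _ measurableSet_Iio]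
          simp [h0]
        rw [h1, one_mul, soloPayoff_eq]
    · show ∀ᵐ x ∂(MixedSpending.pure 0).law, 0 ≤ G.fightPayoff 1 s (.pure m) x
      rw [show (MixedSpending.pure 0).law = Measure.dirac 0 from rfl, ae_dirac_eq]
      exact G.fightPayoff_zero_nonneg 1 s _

variable (G) in
lemma exists_isContestEquilibrium (s : S) : ∃ μ, G.IsContestEquilibrium s μ := by
  by_cases hs : G.Similar s
  · exact hs.exists_isContestEquilibrium
  · exact exists_isContestEquilibrium_of_not_similar hs

end AttackGame

/-! ### The commitment stage. -/

namespace AttackGame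

variable {S : Type*} [Fintype S] (G : AttackGame S)

/-- Net gain of attacker `i` from committing when the other attacker commits with probability `a`,
is worth `D` as an opponent, and leaves `v` when absent. -/
def commitGain (D v a : ℝ) : ℝ := -G.c + G.β * (a * D + (1 - a) * v)

/-- Staying out pays zero, so the payoff is linear in the own commitment probability. -/
lemma payoff_eq (σ : Fin 2 → AttackStrategy S) (i : Fin 2) :
    G.payoff σ i = (σ i).commit * G.commitGain
      (∑ s, G.prob s * G.duelExp i s ((σ i).duel s) ((σ i.rev).duel s))
      (∑ s, G.prob s * G.soloExp i s ((σ i).solo s)) (σ i.rev).commit := by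
  unfold payoff commitGain
  rw [← (finTwoArrowEquiv Bool).symm.sum_comp, Fintype.sum_prod_type]
  fin_cases i <;> simp [outcomeProb, outcomePayoff, Fin.prod_univ_two] <;> ring

/-- The equilibrium value to attacker `i` of facing the other attacker. -/
noncomputable def duelValue (i : Fin 2) : ℝ := ![G.Vlow, 0] i

lemma sum_prob_mul_le {f g : S → ℝ} (h : ∀ s, f s ≤ g s) :
    ∑ s, G.prob s * f s ≤ ∑ s, G.prob s * g s :=
  Finset.sum_le_sum fun s _ => mul_le_mul_of_nonneg_left (h s) (G.prob_nonneg s)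

lemma Vlow_le_V : G.Vlow ≤ G.V 0 := G.sum_prob_mul_le G.contestValueAt_le_soloValueAt

lemma V_one_le_V_zero : G.V 1 ≤ G.V 0 := G.sum_prob_mul_le G.soloValueAt_one_le_zero

lemma V_nonneg (i : Fin 2) : 0 ≤ G.V i :=
  Finset.sum_nonneg fun s _ => mul_nonneg (G.prob_nonneg s) (G.soloValueAt_nonneg i s)

lemma soloExp_pure_optSpending (i : Fin 2) (s : S) :
    G.soloExp i s (.pure (G.optSpending i s).toNNReal) = G.soloValueAt i s := by
  rw [soloExp_pure, Real.coe_toNNReal _ (G.optSpending_nonneg i s), soloValueAt_eq]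

variable {G}

lemma soloExp_eq_of_optimal {i : Fin 2} {s : S} {μ : MixedSpending}
    (h : ∀ ν, G.soloExp i s ν ≤ G.soloExp i s μ) : G.soloExp i s μ = G.soloValueAt i s := by
  refine le_antisymm (G.soloExp_le i s μ) ?_
  rw [← G.soloExp_pure_optSpending]
  exact h _

lemma sum_duelExp_eq {μ : Fin 2 → S → MixedSpending}
    (h : ∀ s, G.IsContestEquilibrium s (fun i => μ i s)) (i : Fin 2) :
    ∑ s, G.prob s * G.duelExp i s (μ i s) (μ i.rev s) = G.duelValue i := by
  fin_cases i
  · exact Finset.sum_congr rfl fun s _ => congrArg _ (h s).duelExp_zero_eq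
  · refine Finset.sum_eq_zero fun s _ => ?_
    exact mul_eq_zero_of_right _ (h s).duelExp_one_eq_zero

lemma sum_soloExp_eq {i : Fin 2} {μ : S → MixedSpending}
    (h : ∀ s ν, G.soloExp i s ν ≤ G.soloExp i s (μ s)) :
    ∑ s, G.prob s * G.soloExp i s (μ s) = G.V i :=
  Finset.sum_congr rfl fun s _ => congrArg _ (soloExp_eq_of_optimal (h s))

lemma commitGain_mono {D D' v v' a : ℝ} (hD : D ≤ D') (hv : v ≤ v') (ha : a ∈ Icc (0 : ℝ) 1) :
    G.commitGain D v a ≤ G.commitGain D' v' a := by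
  have h1 := mul_le_mul_of_nonneg_left hD ha.1
  have h2 := mul_le_mul_of_nonneg_left hv (sub_nonneg.2 ha.2)
  have h3 := mul_le_mul_of_nonneg_left (add_le_add h1 h2) G.β_mem.1
  exact add_le_add_right h3 _

variable (G) in
/-- Net gain of attacker `i` from committing, under optimal play in the reveal stage, when the other
attacker commits with probability `a`. -/
noncomputable def gain (i : Fin 2) (a : ℝ) : ℝ := G.commitGain (G.duelValue i) (G.V i) a

/-- Optimal play in every subgame of the reveal stage. -/
structure OptimalReveal (G : AttackGame S) (σ : Fin 2 → AttackStrategy S) : Prop where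
  duel : ∀ s, G.IsContestEquilibrium s (fun i => (σ i).duel s)
  solo : ∀ i s (ν : MixedSpending), G.soloExp i s ν ≤ G.soloExp i s ((σ i).solo s)

namespace OptimalReveal

variable {σ : Fin 2 → AttackStrategy S}

lemma payoff_eq (h : G.OptimalReveal σ) (i : Fin 2) :
    G.payoff σ i = (σ i).commit * G.gain i (σ i.rev).commit := by
  rw [AttackGame.payoff_eq, sum_soloExp_eq (h.solo i),
    sum_duelExp_eq (μ := fun i => (σ i).duel) h.duel i, gain]

lemma update_withCommit (h : G.OptimalReveal σ) (i : Fin 2) {p : ℝ} (hp : p ∈ Icc (0 : ℝ) 1) :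
    G.OptimalReveal (Function.update σ i ((σ i).withCommit p hp)) := by
  have hd : ∀ j, (Function.update σ i ((σ i).withCommit p hp) j).duel = (σ j).duel := by
    intro j
    rcases eq_or_ne j i with rfl | hj
    · rw [Function.update_self]
      rfl
    · rw [Function.update_of_ne hj]
  have hs : ∀ j, (Function.update σ i ((σ i).withCommit p hp) j).solo = (σ j).solo := by
    intro j
    rcases eq_or_ne j i with rfl | hj
    · rw [Function.update_self]
      rfl
    · rw [Function.update_of_ne hj]
  refine ⟨fun s => ?_, fun j s ν => ?_⟩
  · simpa only [hd] using h.duel s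
  · simpa only [hs] using h.solo j s ν

lemma _root_.Fin.rev_ne_self_of_two (i : Fin 2) : i.rev ≠ i := by fin_cases i <;> decide

lemma payoff_update_withCommit (h : G.OptimalReveal σ) (i : Fin 2) {p : ℝ}
    (hp : p ∈ Icc (0 : ℝ) 1) :
    G.payoff (Function.update σ i ((σ i).withCommit p hp)) i =
      p * G.gain i (σ i.rev).commit := by
  rw [(h.update_withCommit i hp).payoff_eq i, Function.update_self,
    Function.update_of_ne (Fin.rev_ne_self_of_two i)]
  rfl

/-- A deviation may also change reveal-stage play, but that can only lower the gain from committing.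
-/
lemma payoff_update_le (h : G.OptimalReveal σ) (i : Fin 2) (τ : AttackStrategy S) :
    G.payoff (Function.update σ i τ) i ≤ τ.commit * G.gain i (σ i.rev).commit := by
  rw [AttackGame.payoff_eq, Function.update_self,
    Function.update_of_ne (Fin.rev_ne_self_of_two i)]
  refine mul_le_mul_of_nonneg_left (commitGain_mono ?_ ?_ (σ i.rev).commit_mem) τ.commit_mem.1
  · rw [← sum_duelExp_eq (μ := fun i => (σ i).duel) h.duel i]
    exact G.sum_prob_mul_le fun s => h.duel s i _
  · rw [← sum_soloExp_eq (h.solo i)]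
    exact G.sum_prob_mul_le fun s => h.solo i s _

lemma isSubgamePerfect_iff (h : G.OptimalReveal σ) :
    G.IsSubgamePerfect σ ↔ ∀ i, ∀ p ∈ Icc (0 : ℝ) 1,
      p * G.gain i (σ i.rev).commit ≤ (σ i).commit * G.gain i (σ i.rev).commit := by
  refine ⟨fun hσ i p hp => ?_, fun hσ => ⟨h.duel, h.solo, fun i τ => ?_⟩⟩
  · rw [← h.payoff_update_withCommit i hp, ← h.payoff_eq i]
    exact hσ.whole i _
  · rw [h.payoff_eq i]
    exact (h.payoff_update_le i τ).trans (hσ i _ τ.commit_mem)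

end OptimalReveal

lemma IsSubgamePerfect.optimalReveal {σ : Fin 2 → AttackStrategy S} (h : G.IsSubgamePerfect σ) :
    G.OptimalReveal σ := ⟨h.duel, h.solo⟩

variable (G) in
lemma exists_optimalReveal (a : Fin 2 → ℝ) (ha : ∀ i, a i ∈ Icc (0 : ℝ) 1) :
    ∃ σ : Fin 2 → AttackStrategy S, G.OptimalReveal σ ∧ ∀ i, (σ i).commit = a i := by
  choose μ hμ using G.exists_isContestEquilibrium
  refine ⟨fun i => ⟨a i, ha i, fun s => .pure (G.optSpending i s).toNNReal,
    fun s => μ s i⟩, ⟨hμ, fun i s ν => ?_⟩, fun _ => rfl⟩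
  exact (G.soloExp_le i s ν).trans_eq (G.soloExp_pure_optSpending i s).symm

/-- `x` is a best commitment probability when committing gains `g`. -/
def IsBestCommit (x g : ℝ) : Prop := ∀ p ∈ Icc (0 : ℝ) 1, p * g ≤ x * g

lemma isBestCommit_one {g : ℝ} (hg : 0 ≤ g) : IsBestCommit 1 g :=
  fun _ hp => mul_le_mul_of_nonneg_right hp.2 hg

lemma isBestCommit_zero {g : ℝ} (hg : g ≤ 0) : IsBestCommit 0 g :=
  fun _ hp => mul_le_mul_of_nonpos_right hp.1 hg

lemma isBestCommit_of_eq_zero (x : ℝ) {g : ℝ} (hg : g = 0) : IsBestCommit x g :=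
  fun p _ => by rw [hg, mul_zero, mul_zero]

lemma IsBestCommit.eq_one {x g : ℝ} (h : IsBestCommit x g) (hx : x ∈ Icc (0 : ℝ) 1) (hg : 0 < g) :
    x = 1 :=
  le_antisymm hx.2 (le_of_mul_le_mul_right (h 1 (by simp)) hg)

lemma IsBestCommit.eq_zero {x g : ℝ} (h : IsBestCommit x g) (hx : x ∈ Icc (0 : ℝ) 1) (hg : g < 0) :
    x = 0 := by
  have := h 0 (by simp)
  rw [zero_mul] at this
  exact le_antisymm (nonpos_of_mul_nonneg_left this hg) hx.1

variable (G) in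
lemma mem_equilibriumCommitments_iff (x y : ℝ) :
    (x, y) ∈ G.equilibriumCommitments ↔ x ∈ Icc (0 : ℝ) 1 ∧ y ∈ Icc (0 : ℝ) 1 ∧
      IsBestCommit x (G.gain 0 y) ∧ IsBestCommit y (G.gain 1 x) := by
  constructor
  · rintro ⟨σ, hσ, hxy⟩
    obtain ⟨rfl, rfl⟩ := Prod.mk.inj hxy
    have h := hσ.optimalReveal.isSubgamePerfect_iff.1 hσ
    exact ⟨(σ 0).commit_mem, (σ 1).commit_mem, h 0, h 1⟩
  · rintro ⟨hx, hy, h0, h1⟩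
    obtain ⟨σ, hσ, hc⟩ := G.exists_optimalReveal ![x, y] (by intro i; fin_cases i; exacts [hx, hy])
    have hc0 : (σ 0).commit = x := hc 0
    have hc1 : (σ 1).commit = y := hc 1
    refine ⟨σ, hσ.isSubgamePerfect_iff.2 fun i => ?_, by rw [hc0, hc1]⟩
    fin_cases i
    · show IsBestCommit (σ 0).commit (G.gain 0 (σ 1).commit)
      rwa [hc0, hc1]
    · show IsBestCommit (σ 1).commit (G.gain 1 (σ 0).commit)
      rwa [hc0, hc1]

variable (G) in
lemma gain_zero_eq (a : ℝ) :
    G.gain 0 a = -G.c + (G.β * G.V 0 - a * (G.β * G.V 0 - G.β * G.Vlow)) := by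
  simp only [gain, commitGain, duelValue, Matrix.cons_val_zero]
  ring

variable (G) in
lemma gain_one_eq (a : ℝ) : G.gain 1 a = -G.c + (1 - a) * (G.β * G.V 1) := by
  simp only [gain, commitGain, duelValue, Matrix.cons_val_one, Matrix.cons_val_fin_one]
  ring

/-- Facing a certain opponent, the weak attacker wins nothing in expectation and still pays for his
message. -/
lemma gain_one_one_neg : G.gain 1 1 < 0 := by
  rw [gain_one_eq]
  linarith [G.c_pos]

lemma one_zero_mem_equilibriumCommitments (h : G.c ≤ G.β * G.V 0) :
    (1, 0) ∈ G.equilibriumCommitments := by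
  refine (G.mem_equilibriumCommitments_iff 1 0).2 ⟨by simp, by simp, isBestCommit_one ?_,
    isBestCommit_zero gain_one_one_neg.le⟩
  rw [gain_zero_eq]
  linarith

lemma β_mul_Vlow_le : G.β * G.Vlow ≤ G.β * G.V 0 :=
  mul_le_mul_of_nonneg_left G.Vlow_le_V G.β_mem.1

lemma β_mul_V_one_le : G.β * G.V 1 ≤ G.β * G.V 0 :=
  mul_le_mul_of_nonneg_left G.V_one_le_V_zero G.β_mem.1

lemma β_mul_V_nonneg (i : Fin 2) : 0 ≤ G.β * G.V i := mul_nonneg G.β_mem.1 (G.V_nonneg i)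

lemma gain_one_le (a : ℝ) (ha : 0 ≤ a) : G.gain 1 a ≤ -G.c + G.β * G.V 1 := by
  rw [gain_one_eq]
  nlinarith [mul_nonneg ha (β_mul_V_nonneg (G := G) 1)]

lemma gain_zero_le (a : ℝ) (ha : 0 ≤ a) : G.gain 0 a ≤ -G.c + G.β * G.V 0 := by
  rw [gain_zero_eq]
  nlinarith [mul_nonneg ha (sub_nonneg.2 (β_mul_Vlow_le (G := G)))]

lemma le_gain_zero (a : ℝ) (ha : a ≤ 1) : -G.c + G.β * G.Vlow ≤ G.gain 0 a := by
  rw [gain_zero_eq]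
  nlinarith [mul_nonneg (sub_nonneg.2 ha) (sub_nonneg.2 (β_mul_Vlow_le (G := G)))]

lemma one_one_notMem_equilibriumCommitments : (1, 1) ∉ G.equilibriumCommitments := by
  intro h
  obtain ⟨-, hy, -, h1⟩ := (G.mem_equilibriumCommitments_iff 1 1).1 h
  exact one_ne_zero (h1.eq_zero hy gain_one_one_neg)

/-- One attacker has a dominant choice: either the strong one gains even against a certain opponent,
or the weak one loses even when alone. The other's best reply is then strict. -/
lemma equilibriumCommitments_eq_one_zero
    (h : G.c < G.β * G.Vlow ∨
      (G.c < G.β * G.V 0 ∧ G.β * G.Vlow ≤ G.c ∧ G.β * G.V 1 < G.c)) :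
    G.equilibriumCommitments = {(1, 0)} := by
  refine eq_singleton_iff_unique_mem.2 ⟨one_zero_mem_equilibriumCommitments ?_, ?_⟩
  · rcases h with h | h
    · exact h.le.trans β_mul_Vlow_le
    · exact h.1.le
  rintro ⟨x, y⟩ hxy
  obtain ⟨hx, hy, h0, h1⟩ := (G.mem_equilibriumCommitments_iff x y).1 hxy
  rcases h with h | ⟨h, -, h'⟩
  · obtain rfl := h0.eq_one hx (by linarith [le_gain_zero (G := G) y hy.2])
    rw [h1.eq_zero hy gain_one_one_neg]
  · obtain rfl := h1.eq_zero hy (by linarith [gain_one_le (G := G) x hx.1])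
    rw [h0.eq_one hx (by rw [gain_zero_eq]; linarith)]

lemma equilibriumCommitments_eq_zero_zero (h : G.β * G.V 0 < G.c) :
    G.equilibriumCommitments = {(0, 0)} := by
  have hg0 : ∀ a, 0 ≤ a → G.gain 0 a < 0 := fun a ha => by linarith [gain_zero_le (G := G) a ha]
  have hg1 : ∀ a, 0 ≤ a → G.gain 1 a < 0 := fun a ha => by
    linarith [gain_one_le (G := G) a ha, β_mul_V_one_le (G := G)]
  refine eq_singleton_iff_unique_mem.2 ⟨(G.mem_equilibriumCommitments_iff 0 0).2
    ⟨by simp, by simp, isBestCommit_zero (hg0 0 le_rfl).le, isBestCommit_zero (hg1 0 le_rfl).le⟩, ?_⟩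
  rintro ⟨x, y⟩ hxy
  obtain ⟨hx, hy, h0, h1⟩ := (G.mem_equilibriumCommitments_iff x y).1 hxy
  rw [h0.eq_zero hx (hg0 y hy.1), h1.eq_zero hy (hg1 x hx.1)]

lemma zero_zero_mem_equilibriumCommitments (h : G.β * G.V 0 = G.c) :
    (0, 0) ∈ G.equilibriumCommitments :=
  (G.mem_equilibriumCommitments_iff 0 0).2 ⟨by simp, by simp,
    isBestCommit_zero (by linarith [gain_zero_le (G := G) 0 le_rfl]),
    isBestCommit_zero (by linarith [gain_one_le (G := G) 0 le_rfl, β_mul_V_one_le (G := G)])⟩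

/-- With gains that change sign, the equilibria are the two asymmetric pure ones and the mixed one
that makes both attackers indifferent. -/
lemma equilibriumCommitments_eq_of_indifferent {α₁ α₂ : ℝ} (hα₁ : α₁ ∈ Ioo (0 : ℝ) 1)
    (hα₂ : α₂ ∈ Ioo (0 : ℝ) 1) (h0 : G.c < G.β * G.V 0) (hlow : G.β * G.Vlow < G.c)
    (h1 : G.c < G.β * G.V 1) (hg1 : G.gain 1 α₁ = 0) (hg0 : G.gain 0 α₂ = 0) :
    G.equilibriumCommitments = {(1, 0), (0, 1), (α₁, α₂)} := by
  ext ⟨x, y⟩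
  simp only [mem_insert_iff, mem_singleton_iff]
  constructor
  · intro hxy
    obtain ⟨hx, hy, hb0, hb1⟩ := (G.mem_equilibriumCommitments_iff x y).1 hxy
    -- A nonzero gain makes the strong attacker's choice pure, and then the weak one's. A zero gain
    -- fixes `y = α₂`; being interior, it forces the weak attacker's indifference, which fixes `x`.
    rcases lt_trichotomy (G.gain 0 y) 0 with hg | hg | hg
    · obtain rfl := hb0.eq_zero hx hg
      rw [hb1.eq_one hy (by rw [gain_one_eq]; linarith)]
      simp
    · have hyα : y = α₂ := by
        rw [gain_zero_eq] at hg hg0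
        refine mul_right_cancel₀ (b := G.β * G.V 0 - G.β * G.Vlow) (by linarith) ?_
        linarith
      subst hyα
      have hgx : G.gain 1 x = 0 := by
        rcases lt_trichotomy (G.gain 1 x) 0 with h | h | h
        · exact absurd (hb1.eq_zero hy h) hα₂.1.ne'
        · exact h
        · exact absurd (hb1.eq_one hy h) hα₂.2.ne
      have hxα : x = α₁ := by
        rw [gain_one_eq] at hgx hg1
        refine mul_right_cancel₀ (b := G.β * G.V 1) (by linarith [G.c_pos]) ?_
        linarith
      simp [hxα]
    · obtain rfl := hb0.eq_one hx hg
      rw [hb1.eq_zero hy gain_one_one_neg]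
      simp
  · rintro (h | h | h) <;> obtain ⟨rfl, rfl⟩ := Prod.mk.inj h
    · exact one_zero_mem_equilibriumCommitments h0.le
    · refine (G.mem_equilibriumCommitments_iff 0 1).2 ⟨by simp, by simp, isBestCommit_zero ?_,
        isBestCommit_one ?_⟩
      · rw [gain_zero_eq]
        linarith
      · rw [gain_one_eq]
        linarith
    · exact (G.mem_equilibriumCommitments_iff x y).2 ⟨Ioo_subset_Icc_self hα₁,
        Ioo_subset_Icc_self hα₂, isBestCommit_of_eq_zero x hg0, isBestCommit_of_eq_zero y hg1⟩

end AttackGame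

/-! ### Assembly, with the mixed pair solved from the indifference equations. -/

theorem mainTheorem4 {S : Type*} [Fintype S] (G : AttackGame S) :
    -- reveal stage: the values `V` and `Vlow` are the equilibrium values
    (∀ s,
      (∀ i, IsGreatest (G.soloPayoff i s '' Set.Ici 0) (G.soloValueAt i s)) ∧
      (∃ μ, G.IsContestEquilibrium s μ) ∧
      (∀ μ, G.IsContestEquilibrium s μ →
        G.duelExp 0 s (μ 0) (μ 1) = G.contestValueAt s ∧ G.duelExp 1 s (μ 1) (μ 0) = 0) ∧
      (G.Similar s → G.contestValueAt s < G.soloValueAt 0 s)) ∧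
    -- no equilibrium in which both attackers commit with probability one
    (1, 1) ∉ G.equilibriumCommitments ∧
    -- only the strong attacker commits
    ((G.c < G.β * G.Vlow ∨
        (G.c < G.β * G.V 0 ∧ G.β * G.Vlow ≤ G.c ∧ G.β * G.V 1 < G.c)) →
      G.equilibriumCommitments = {(1, 0)}) ∧
    -- two pure equilibria and a mixed one
    ((G.c < G.β * G.V 0 ∧ G.β * G.Vlow < G.c ∧ G.c < G.β * G.V 1) →
      ∃ α₁ α₂ : ℝ, α₁ ∈ Set.Ioo (0 : ℝ) 1 ∧ α₂ ∈ Set.Ioo (0 : ℝ) 1 ∧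
        G.β * ((1 - α₁) * G.V 1) = G.c ∧
        G.β * ((1 - α₂) * G.V 0 + α₂ * G.Vlow) = G.c ∧
        G.equilibriumCommitments = {(1, 0), (0, 1), (α₁, α₂)} ∧
        ∀ σ : Fin 2 → AttackStrategy S, G.IsSubgamePerfect σ →
          (σ 0).commit = α₁ → (σ 1).commit = α₂ →
          (∀ (i : Fin 2) (p : ℝ) (hp : p ∈ Set.Icc (0 : ℝ) 1),
            G.payoff (Function.update σ i ((σ i).withCommit p hp)) i = G.payoff σ i) ∧
          outcomeProb σ ![true, true] = α₁ * α₂ ∧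
          outcomeProb σ ![false, false] = (1 - α₁) * (1 - α₂) ∧
          outcomeProb σ ![true, false] + outcomeProb σ ![false, true] =
            1 - α₁ * α₂ - (1 - α₁) * (1 - α₂)) ∧
    -- no attacker commits
    (G.β * G.V 0 < G.c → G.equilibriumCommitments = {(0, 0)}) ∧
    (G.β * G.V 0 = G.c → (0, 0) ∈ G.equilibriumCommitments) := by
  refine ⟨fun s => ⟨fun i => ?_, G.exists_isContestEquilibrium s,
    fun μ hμ => ⟨hμ.duelExp_zero_eq, hμ.duelExp_one_eq_zero⟩,
    fun hs => G.contestValueAt_lt_soloValueAt hs⟩,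
    AttackGame.one_one_notMem_equilibriumCommitments,
    AttackGame.equilibriumCommitments_eq_one_zero, ?_,
    AttackGame.equilibriumCommitments_eq_zero_zero,
    AttackGame.zero_zero_mem_equilibriumCommitments⟩
  · rw [G.soloValueAt_eq]
    exact G.soloValueAt_isGreatest i s
  rintro ⟨h0, hlow, h1⟩
  have hV1 : 0 < G.β * G.V 1 := G.c_pos.trans h1
  have hdiff : 0 < G.β * G.V 0 - G.β * G.Vlow := by linarith
  obtain ⟨α₁, hα₁⟩ : ∃ α, (1 - α) * (G.β * G.V 1) = G.c :=
    ⟨1 - G.c / (G.β * G.V 1), by rw [sub_sub_cancel, div_mul_cancel₀ _ hV1.ne']⟩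
  obtain ⟨α₂, hα₂⟩ : ∃ α, α * (G.β * G.V 0 - G.β * G.Vlow) = G.β * G.V 0 - G.c :=
    ⟨_, div_mul_cancel₀ _ hdiff.ne'⟩
  -- The upper bound on `α₁` comes from the positive cost, the lower one from the weak attacker's
  -- profit when alone.
  have hm₁ : α₁ ∈ Set.Ioo (0 : ℝ) 1 := by
    have hc := G.c_pos
    constructor <;> by_contra! h <;> nlinarith
  have hm₂ : α₂ ∈ Set.Ioo (0 : ℝ) 1 := by
    constructor <;> by_contra! h <;> nlinarith
  have hg1 : G.gain 1 α₁ = 0 := by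
    rw [G.gain_one_eq]
    linarith
  have hg0 : G.gain 0 α₂ = 0 := by
    rw [G.gain_zero_eq]
    linarith
  refine ⟨α₁, α₂, hm₁, hm₂, by linarith, by linarith,
    AttackGame.equilibriumCommitments_eq_of_indifferent hm₁ hm₂ h0 hlow h1 hg1 hg0,
    fun σ hσ hc0 hc1 => ⟨fun i p hp => ?_, ?_, ?_, ?_⟩⟩
  · have hz : G.gain i (σ i.rev).commit = 0 := by
      fin_cases i
      · exact (congrArg (G.gain 0) hc1).trans hg0
      · exact (congrArg (G.gain 1) hc0).trans hg1
    rw [hσ.optimalReveal.payoff_update_withCommit, hσ.optimalReveal.payoff_eq, hz, mul_zero,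
      mul_zero]
  · simp [outcomeProb, Fin.prod_univ_two, hc0, hc1]
  · simp [outcomeProb, Fin.prod_univ_two, hc0, hc1]
  · simp [outcomeProb, Fin.prod_univ_two, hc0, hc1]
    ring
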